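/- Let $F$ denote R. Thompson's group, i.e. the group of all piecewise-linear increasing self-homeomorphisms of $[0,1]$ (with finitely many linear pieces) all of whose slopes are powers of $2$ and all of whose break points lie in $\mathbb{Z}[\frac12]$. For $U\subset(0,1)$ let $H_U=\{f\in F: f(u)=u \text{ for all } u\in U\}$ be the pointwise stabilizer of $U$ in $F$. Let $U$ be a finite subset of $(0,1)$. Let $U_1=U\cap\mathbb{Z}[\frac12]$ be the set of dyadic numbers in $U$, let $U_2$ be the set of rational numbers in $U$ not belonging to $\mathbb{Z}[\frac12]$, and let $U_3$ be the set of irrational numbers in $U$. Put $m_i=|U_i|$ for $i=1,2,3$ and $r=|U|=m_1+m_2+m_3$. Then $H_U$ is isomorphic to a semidirect product $$H_U\cong [F,F]^{\,r+1}\rtimes \mathbb{Z}^{2m_1+m_2+2}$$ (for some action of $\mathbb{Z}^{2m_1+m_2+2}$ on $[F,F]^{\,r+1}$ by automorphisms). Moreover, the first integral homology group $H_1(H_U;\mathbb{Z})$ has rank $2m_1+m_2+2$. -/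

import Mathlib

open scoped unitInterval

/-- `x ∈ ℤ[1/2]`. -/
def IsDyadic (x : ℝ) : Prop := ∃ (a : ℤ) (n : ℕ), x = a / 2 ^ n

theorem IsDyadic.add {x y : ℝ} (hx : IsDyadic x) (hy : IsDyadic y) : IsDyadic (x + y) := by
  obtain ⟨a, n, rfl⟩ := hx
  obtain ⟨b, m, rfl⟩ := hy
  refine ⟨a * 2 ^ m + b * 2 ^ n, n + m, ?_⟩
  push_cast
  field_simp
  ring

theorem IsDyadic.neg {x : ℝ} (hx : IsDyadic x) : IsDyadic (-x) := by
  obtain ⟨a, n, rfl⟩ := hx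
  exact ⟨-a, n, by push_cast; ring⟩

theorem IsDyadic.zpow_mul {x : ℝ} (k : ℤ) (hx : IsDyadic x) : IsDyadic ((2 : ℝ) ^ k * x) := by
  obtain ⟨a, n, rfl⟩ := hx
  obtain ⟨m, rfl | rfl⟩ := k.eq_nat_or_neg
  · exact ⟨2 ^ m * a, n, by push_cast; rw [zpow_natCast]; ring⟩
  · refine ⟨a, m + n, ?_⟩
    rw [zpow_neg, zpow_natCast, pow_add]
    field_simp

theorem isDyadic_add_zpow_mul_iff {c d x : ℝ} (k : ℤ) (hc : IsDyadic c) (hd : IsDyadic d) :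
    IsDyadic (c + (2 : ℝ) ^ k * (x - d)) ↔ IsDyadic x := by
  constructor
  · intro h
    have h2 := ((h.add hc.neg).zpow_mul (-k)).add hd
    have hk : (2 : ℝ) ^ (-k) * (2 : ℝ) ^ k = 1 := by
      rw [← zpow_add₀ (by norm_num)]; simp
    have e : (2 : ℝ) ^ (-k) * (c + (2 : ℝ) ^ k * (x - d) + -c) + d = x := by
      linear_combination (x - d) * hk
    rwa [e] at h2
  · intro h
    exact hc.add (IsDyadic.zpow_mul k (by rw [sub_eq_add_neg]; exact h.add hd.neg))

/-- The self-homeomorphism `f` of `[0,1]` is piecewise linear, with finitely many pieces, all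
slopes are integer powers of `2`, and all break points of the derivative lie in `ℤ[1/2]`: on every
closed subinterval whose interior contains none of the finitely many points of `B`, the map is
affine with slope a power of `2`. -/
def IsDyadicPL (f : I ≃ₜ I) : Prop :=
  ∃ B : Finset I, (∀ b ∈ B, IsDyadic (b : ℝ)) ∧
    ∀ x y : I, x ≤ y → (∀ b ∈ B, ¬ (x < b ∧ b < y)) →
      ∃ k : ℤ, ∀ t : I, x ≤ t → t ≤ y →
        (f t : ℝ) = (f x : ℝ) + (2 : ℝ) ^ k * ((t : ℝ) - (x : ℝ))

theorem strictMono_map_zero {f : I ≃ₜ I} (hf : StrictMono f) : f 0 = 0 := by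
  apply le_antisymm _ (unitInterval.nonneg' (t := f 0))
  have h := hf.monotone (unitInterval.nonneg' (t := f.symm 0))
  rwa [f.apply_symm_apply] at h

theorem IsDyadicPL.isDyadic_iff {f : I ≃ₜ I} (hf : StrictMono f) (h : IsDyadicPL f) (x : I) :
    IsDyadic (f x : ℝ) ↔ IsDyadic (x : ℝ) := by
  classical
  obtain ⟨B, hB, hpl⟩ := h
  have h0 : IsDyadic 0 := ⟨0, 0, by simp⟩
  suffices H : ∀ n : ℕ, ∀ x : I, (B.filter (· < x)).card = n →
      (IsDyadic (f x : ℝ) ↔ IsDyadic (x : ℝ)) from H _ x rfl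
  intro n
  induction n using Nat.strong_induction_on with
  | _ n ih =>
    intro x hx
    have hx0 : (0 : I) ≤ x := unitInterval.nonneg'
    by_cases hne : (B.filter (· < x)).Nonempty
    · set b := (B.filter (· < x)).max' hne with hbdef
      have hb := (B.filter (· < x)).max'_mem hne
      rw [← hbdef, Finset.mem_filter] at hb
      obtain ⟨k, hk⟩ := hpl b x hb.2.le (by
        rintro c hc ⟨h1, h2⟩
        exact absurd h1 (not_lt.2 (Finset.le_max' _ c (Finset.mem_filter.2 ⟨hc, h2⟩))))
      rw [hk x hb.2.le le_rfl]
      refine isDyadic_add_zpow_mul_iff k ?_ (hB b hb.1)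
      refine (ih _ ?_ b rfl).2 (hB b hb.1)
      rw [← hx]
      apply Finset.card_lt_card
      refine ⟨fun c hc => ?_, fun hss => ?_⟩
      · rw [Finset.mem_filter] at hc ⊢
        exact ⟨hc.1, hc.2.trans hb.2⟩
      · have := hss (Finset.mem_filter.2 hb)
        simp at this
    · obtain ⟨k, hk⟩ := hpl 0 x hx0 (by
        rintro c hc ⟨-, h2⟩
        exact hne ⟨c, Finset.mem_filter.2 ⟨hc, h2⟩⟩)
      rw [hk x hx0 le_rfl, strictMono_map_zero hf]
      exact isDyadic_add_zpow_mul_iff k h0 h0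

theorem IsDyadicPL.mul {f g : I ≃ₜ I} (hf : IsDyadicPL f) (hg : IsDyadicPL g)
    (mg : StrictMono g) : IsDyadicPL (f * g) := by
  classical
  have hdy := hg.isDyadic_iff mg
  obtain ⟨B, hB, hBpl⟩ := hf
  obtain ⟨C, hC, hCpl⟩ := hg
  refine ⟨C ∪ B.image g.symm, ?_, ?_⟩
  · intro b hb
    rcases Finset.mem_union.1 hb with hb | hb
    · exact hC b hb
    · obtain ⟨c, hc, rfl⟩ := Finset.mem_image.1 hb
      rw [← hdy, g.apply_symm_apply]
      exact hB c hc
  · intro x y hxy hno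
    obtain ⟨k, hk⟩ := hCpl x y hxy (fun b hb => hno b (Finset.mem_union_left _ hb))
    obtain ⟨l, hl⟩ := hBpl (g x) (g y) (mg.monotone hxy) (by
      rintro b hb ⟨h1, h2⟩
      refine hno (g.symm b) (Finset.mem_union_right _ (Finset.mem_image_of_mem _ hb)) ⟨?_, ?_⟩
      · rw [← mg.lt_iff_lt, g.apply_symm_apply]; exact h1
      · rw [← mg.lt_iff_lt, g.apply_symm_apply]; exact h2)
    refine ⟨l + k, fun t h1 h2 => ?_⟩
    have e1 := hl (g t) (mg.monotone h1) (mg.monotone h2)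
    rw [hk t h1 h2] at e1
    change (f (g t) : ℝ) = (f (g x) : ℝ) + _
    rw [e1, zpow_add₀ (by norm_num)]
    ring

theorem IsDyadicPL.inv {f : I ≃ₜ I} (hf : IsDyadicPL f) (mf : StrictMono f) :
    IsDyadicPL f⁻¹ := by
  classical
  have hdy := hf.isDyadic_iff mf
  obtain ⟨B, hB, hpl⟩ := hf
  refine ⟨B.image f, ?_, ?_⟩
  · intro b hb
    obtain ⟨c, hc, rfl⟩ := Finset.mem_image.1 hb
    exact (hdy c).2 (hB c hc)
  · intro x y hxy hno
    obtain ⟨x, rfl⟩ := f.surjective x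
    obtain ⟨y, rfl⟩ := f.surjective y
    obtain ⟨k, hk⟩ := hpl x y (mf.le_iff_le.1 hxy) (by
      rintro b hb ⟨h1, h2⟩
      exact hno (f b) (Finset.mem_image_of_mem _ hb) ⟨mf h1, mf h2⟩)
    refine ⟨-k, fun t h1 h2 => ?_⟩
    obtain ⟨t, rfl⟩ := f.surjective t
    have e := hk t (mf.le_iff_le.1 h1) (mf.le_iff_le.1 h2)
    change (f.symm (f t) : ℝ) = (f.symm (f x) : ℝ) + _
    rw [f.symm_apply_apply, f.symm_apply_apply, e]
    have hk' : (2 : ℝ) ^ (-k) * (2 : ℝ) ^ k = 1 := by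
      rw [← zpow_add₀ (by norm_num)]; simp
    linear_combination (-((t : ℝ) - x)) * hk'

/-- R. Thompson's group `F`: all piecewise-linear increasing self-homeomorphisms of `[0,1]` all of
whose slopes are powers of `2` and all of whose break points are in `ℤ[1/2]`. -/
def thompsonF : Subgroup (I ≃ₜ I) where
  carrier := {f | StrictMono f ∧ IsDyadicPL f}
  one_mem' := ⟨strictMono_id, ∅, by simp, fun x y _ _ => ⟨0, fun t _ _ => by simp⟩⟩
  mul_mem' := fun {f g} hf hg => ⟨hf.1.comp hg.1, hf.2.mul hg.2 hg.1⟩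
  inv_mem' := fun {f} hf => ⟨fun x y hxy => by
    rw [← hf.1.lt_iff_lt]
    change f (f.symm x) < f (f.symm y)
    rwa [f.apply_symm_apply, f.apply_symm_apply], hf.2.inv hf.1⟩

/-- The pointwise stabilizer `H_U` of a set `U` of numbers in Thompson's group `F`. -/
def pointStabilizer (U : Set ℝ) : Subgroup thompsonF where
  carrier := {f | ∀ x : I, (x : ℝ) ∈ U → (f : I ≃ₜ I) x = x}
  one_mem' := fun _ _ => rfl
  mul_mem' := fun {f g} hf hg x hx => by
    change (f : I ≃ₜ I) ((g : I ≃ₜ I) x) = x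
    rw [hg x hx, hf x hx]
  inv_mem' := fun {f} hf x hx => by
    change (f : I ≃ₜ I).symm x = x
    rw [Homeomorph.symm_apply_eq, hf x hx]

/-- The class `U₁` of the natural partition: the elements of `U` in `ℤ[1/2]`. -/
def dyadicPart (U : Set ℝ) : Set ℝ := {x ∈ U | IsDyadic x}

/-- The class `U₂` of the natural partition: the rational elements of `U` not in `ℤ[1/2]`.
(The remaining class `U₃` consists of the irrational elements of `U`.) -/
def rationalPart (U : Set ℝ) : Set ℝ := {x ∈ U | ¬ Irrational x ∧ ¬ IsDyadic x}

namespace Thompson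

open Filter Topology Set

/-! ### Dyadic numbers and dyadic affine maps -/

theorem isDyadic_intCast (n : ℤ) : IsDyadic n := ⟨n, 0, by simp⟩

theorem isDyadic_zero : IsDyadic 0 := by simpa using isDyadic_intCast 0

theorem isDyadic_one : IsDyadic 1 := by simpa using isDyadic_intCast 1

theorem isDyadic_sub {x y : ℝ} (hx : IsDyadic x) (hy : IsDyadic y) : IsDyadic (x - y) := by
  rw [sub_eq_add_neg]; exact hx.add hy.neg

theorem isDyadic_zpow (k : ℤ) : IsDyadic ((2 : ℝ) ^ k) := by
  simpa using isDyadic_one.zpow_mul k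

theorem isDyadic_zpow_mul_add_iff {d x : ℝ} (k : ℤ) (hd : IsDyadic d) :
    IsDyadic ((2 : ℝ) ^ k * x + d) ↔ IsDyadic x := by
  have := isDyadic_add_zpow_mul_iff (x := x) k hd isDyadic_zero
  rwa [sub_zero, add_comm] at this

theorem two_zpow_pos (k : ℤ) : (0 : ℝ) < (2 : ℝ) ^ k := zpow_pos (by norm_num) k

theorem exists_dyadic_btwn {x y : ℝ} (h : x < y) : ∃ d, IsDyadic d ∧ x < d ∧ d < y := by
  obtain ⟨n, hn⟩ := exists_nat_gt (y - x)⁻¹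
  have hp : (0 : ℝ) < y - x := sub_pos.2 h
  have h2 : (y - x)⁻¹ < 2 ^ n := hn.trans (by exact_mod_cast Nat.lt_two_pow_self)
  have h3 : (0 : ℝ) < 2 ^ n := by positivity
  have h4 : 1 < (y - x) * 2 ^ n := by
    rw [inv_lt_iff_one_lt_mul₀ hp] at h2; linarith
  refine ⟨(⌊x * 2 ^ n⌋ + 1 : ℤ) / 2 ^ n, ⟨_, n, rfl⟩, ?_, ?_⟩
  · rw [lt_div_iff₀ h3]; push_cast; exact Int.lt_floor_add_one _
  · rw [div_lt_iff₀ h3]; push_cast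
    have := Int.floor_le (x * 2 ^ n)
    nlinarith

/-- Affine maps whose slope is a power of `2` and whose constant term is dyadic. -/
def DyadicAffine (A : ℝ → ℝ) : Prop := ∃ (k : ℤ) (d : ℝ), IsDyadic d ∧ ∀ t, A t = 2 ^ k * t + d

namespace DyadicAffine

variable {A B : ℝ → ℝ}

theorem mk (k : ℤ) {d : ℝ} (hd : IsDyadic d) : DyadicAffine fun t => 2 ^ k * t + d :=
  ⟨k, d, hd, fun _ => rfl⟩

theorem id : DyadicAffine fun t => t := ⟨0, 0, isDyadic_zero, by simp⟩

theorem comp (hB : DyadicAffine B) (hA : DyadicAffine A) : DyadicAffine fun t => B (A t) := by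
  obtain ⟨k, d, hd, hA⟩ := hA
  obtain ⟨l, e, he, hB⟩ := hB
  refine ⟨l + k, 2 ^ l * d + e, (hd.zpow_mul l).add he, fun t => ?_⟩
  simp only [hB, hA, zpow_add₀ (two_ne_zero' ℝ)]
  ring

theorem exists_inverse (hA : DyadicAffine A) :
    ∃ B, DyadicAffine B ∧ (∀ t, A (B t) = t) ∧ ∀ t, B (A t) = t := by
  obtain ⟨k, d, hd, hA⟩ := hA
  have h : (2 : ℝ) ^ k * 2 ^ (-k) = 1 := by rw [← zpow_add₀ (by norm_num)]; simp
  refine ⟨fun t => 2 ^ (-k) * t + -(2 ^ (-k) * d), mk (-k) (hd.zpow_mul _).neg,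
    fun t => ?_, fun t => ?_⟩
  · rw [hA]; linear_combination (t - d) * h
  · simp only [hA]; linear_combination t * h

theorem strictMono (hA : DyadicAffine A) : StrictMono A := by
  obtain ⟨k, d, hd, hA⟩ := hA
  intro x y h
  rw [hA, hA]
  have := mul_lt_mul_of_pos_left h (two_zpow_pos k)
  linarith

theorem continuous (hA : DyadicAffine A) : Continuous A := by
  obtain ⟨k, d, hd, hA⟩ := hA
  rw [show A = fun t => 2 ^ k * t + d from funext hA]
  fun_prop

theorem isDyadic_iff (hA : DyadicAffine A) (x : ℝ) : IsDyadic (A x) ↔ IsDyadic x := by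
  obtain ⟨k, d, hd, hA⟩ := hA
  rw [hA, isDyadic_zpow_mul_add_iff k hd]

theorem eq_of_eq_at_two (hA : DyadicAffine A) (hB : DyadicAffine B) {x y : ℝ} (hxy : x ≠ y)
    (hx : A x = B x) (hy : A y = B y) : A = B := by
  obtain ⟨k, d, hd, hA⟩ := hA
  obtain ⟨l, e, he, hB⟩ := hB
  rw [hA, hB] at hx hy
  have h : ((2 : ℝ) ^ k - 2 ^ l) * (x - y) = 0 := by linear_combination hx - hy
  have h1 : (2 : ℝ) ^ k = 2 ^ l :=
    sub_eq_zero.1 ((mul_eq_zero.1 h).resolve_right (sub_ne_zero.2 hxy))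
  funext t
  rw [hA, hB]
  rw [h1] at hx ⊢
  linarith

theorem tendsto_nhdsGE (hA : DyadicAffine A) (x : ℝ) : Tendsto A (𝓝[≥] x) (𝓝[≥] (A x)) :=
  tendsto_nhdsWithin_iff.2 ⟨hA.continuous.continuousAt.mono_left nhdsWithin_le_nhds,
    eventually_mem_nhdsWithin.mono fun _ h => hA.strictMono.monotone h⟩

theorem tendsto_nhdsLE (hA : DyadicAffine A) (x : ℝ) : Tendsto A (𝓝[≤] x) (𝓝[≤] (A x)) :=
  tendsto_nhdsWithin_iff.2 ⟨hA.continuous.continuousAt.mono_left nhdsWithin_le_nhds,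
    eventually_mem_nhdsWithin.mono fun _ h => hA.strictMono.monotone h⟩

end DyadicAffine

/-! ### Locally piecewise linear dyadic maps -/

/-- `f` agrees with a dyadic affine map along the filter `l`. -/
def AffineAlong (l : Filter ℝ) (f : ℝ → ℝ) : Prop := ∃ A, DyadicAffine A ∧ f =ᶠ[l] A

/-- Near `x`, the map `f` is dyadic affine on either side of `x`, with no break at `x` unless `x`
is dyadic. -/
structure LocPLAt (f : ℝ → ℝ) (x : ℝ) : Prop where
  right : AffineAlong (𝓝[≥] x) f
  left : AffineAlong (𝓝[≤] x) f
  both : ¬ IsDyadic x → AffineAlong (𝓝 x) f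

theorem DyadicAffine.affineAlong {A : ℝ → ℝ} (hA : DyadicAffine A) (l : Filter ℝ) :
    AffineAlong l A := ⟨A, hA, EventuallyEq.rfl⟩

theorem AffineAlong.mono {l l' : Filter ℝ} {f : ℝ → ℝ} (h : AffineAlong l f) (hl : l' ≤ l) :
    AffineAlong l' f := by
  obtain ⟨A, hA, h⟩ := h
  exact ⟨A, hA, h.filter_mono hl⟩

theorem AffineAlong.congr {l : Filter ℝ} {f g : ℝ → ℝ} (h : AffineAlong l f) (e : g =ᶠ[l] f) :
    AffineAlong l g := by
  obtain ⟨A, hA, h⟩ := h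
  exact ⟨A, hA, e.trans h⟩

theorem AffineAlong.locPLAt {f : ℝ → ℝ} {x : ℝ} (h : AffineAlong (𝓝 x) f) : LocPLAt f x :=
  ⟨h.mono nhdsWithin_le_nhds, h.mono nhdsWithin_le_nhds, fun _ => h⟩

theorem DyadicAffine.locPLAt {A : ℝ → ℝ} (hA : DyadicAffine A) (x : ℝ) : LocPLAt A x :=
  (hA.affineAlong _).locPLAt

namespace LocPLAt

variable {f g : ℝ → ℝ} {x : ℝ}

theorem congr (h : LocPLAt f x) (e : g =ᶠ[𝓝 x] f) : LocPLAt g x :=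
  ⟨h.right.congr (e.filter_mono nhdsWithin_le_nhds),
    h.left.congr (e.filter_mono nhdsWithin_le_nhds), fun hx => (h.both hx).congr e⟩

theorem tendsto_nhdsGE (h : LocPLAt f x) : Tendsto f (𝓝[≥] x) (𝓝[≥] (f x)) := by
  obtain ⟨A, hA, h⟩ := h.right
  rw [h.eq_of_nhdsWithin self_mem_Ici]
  exact (hA.tendsto_nhdsGE x).congr' h.symm

theorem tendsto_nhdsLE (h : LocPLAt f x) : Tendsto f (𝓝[≤] x) (𝓝[≤] (f x)) := by
  obtain ⟨A, hA, h⟩ := h.left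
  rw [h.eq_of_nhdsWithin self_mem_Iic]
  exact (hA.tendsto_nhdsLE x).congr' h.symm

theorem continuousAt (h : LocPLAt f x) : ContinuousAt f x := by
  rw [ContinuousAt, ← nhdsLE_sup_nhdsGE]
  exact (h.tendsto_nhdsLE.mono_right nhdsWithin_le_nhds).sup
    (h.tendsto_nhdsGE.mono_right nhdsWithin_le_nhds)

theorem isDyadic_iff (h : LocPLAt f x) : IsDyadic (f x) ↔ IsDyadic x := by
  obtain ⟨A, hA, h⟩ := h.right
  rw [h.eq_of_nhdsWithin self_mem_Ici, hA.isDyadic_iff]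

theorem _root_.Thompson.AffineAlong.comp {l l' : Filter ℝ} (hg : AffineAlong l' g)
    (hf : AffineAlong l f) (ht : Tendsto f l l') : AffineAlong l fun t => g (f t) := by
  obtain ⟨A, hA, h⟩ := hf
  obtain ⟨B, hB, h'⟩ := hg
  refine ⟨_, hB.comp hA, ?_⟩
  filter_upwards [h, ht.eventually h'] with t h1 h2
  rw [h2, h1]

theorem comp (hg : LocPLAt g (f x)) (hf : LocPLAt f x) : LocPLAt (fun t => g (f t)) x :=
  ⟨hg.right.comp hf.right hf.tendsto_nhdsGE, hg.left.comp hf.left hf.tendsto_nhdsLE,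
    fun hx => (hg.both (by rwa [hf.isDyadic_iff])).comp (hf.both hx) hf.continuousAt⟩

/-- Locally `g` must be the inverse of the affine piece of `f`. Only a left inverse is needed, so
this also applies to embeddings of the line that are not onto. -/
theorem leftInverse (hg : ∀ t, g (f t) = t) (hf : LocPLAt f x) : LocPLAt g (f x) := by
  have key : ∀ A B : ℝ → ℝ, ∀ l l' : Filter ℝ, (∀ t, A (B t) = t) → f =ᶠ[l] A →
      Tendsto B l' l → g =ᶠ[l'] B := by
    intro A B l l' hAB h ht
    filter_upwards [ht.eventually h] with t h1
    rw [hAB] at h1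
    rw [← hg (B t), h1]
  refine ⟨?_, ?_, fun hx => ?_⟩
  · obtain ⟨A, hA, h⟩ := hf.right
    obtain ⟨B, hB, h1, h2⟩ := hA.exists_inverse
    refine ⟨B, hB, key A B _ _ h1 h ?_⟩
    have := hB.tendsto_nhdsGE (A x)
    rwa [h2, ← h.eq_of_nhdsWithin self_mem_Ici] at this
  · obtain ⟨A, hA, h⟩ := hf.left
    obtain ⟨B, hB, h1, h2⟩ := hA.exists_inverse
    refine ⟨B, hB, key A B _ _ h1 h ?_⟩
    have := hB.tendsto_nhdsLE (A x)
    rwa [h2, ← h.eq_of_nhdsWithin self_mem_Iic] at this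
  · rw [hf.isDyadic_iff] at hx
    obtain ⟨A, hA, h⟩ := hf.both hx
    obtain ⟨B, hB, h1, h2⟩ := hA.exists_inverse
    refine ⟨B, hB, key A B _ _ h1 h ?_⟩
    have := hB.continuous.tendsto (A x)
    rwa [h2, ← h.eq_of_nhds] at this

end LocPLAt

/-- Order automorphisms of the line that are locally piecewise linear, with slopes powers of `2`,
preserving the dyadic numbers, and with dyadic break points. -/
def locPL : Subgroup (ℝ ≃o ℝ) where
  carrier := {f | ∀ x, LocPLAt f x}
  one_mem' := fun x => DyadicAffine.id.locPLAt x
  mul_mem' := fun {f g} hf hg x => (hf (g x)).comp (hg x)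
  inv_mem' := fun {f} hf x => by
    have := (hf (f.symm x)).leftInverse (g := f.symm) f.symm_apply_apply
    rwa [f.apply_symm_apply] at this

theorem isDyadic_apply_iff {f : ℝ ≃o ℝ} (hf : f ∈ locPL) (x : ℝ) :
    IsDyadic (f x) ↔ IsDyadic x := (hf x).isDyadic_iff

@[simp] theorem inv_apply_self' (f : ℝ ≃o ℝ) (t : ℝ) : f⁻¹ (f t) = t := f.symm_apply_apply t

@[simp] theorem apply_inv_self' (f : ℝ ≃o ℝ) (t : ℝ) : f (f⁻¹ t) = t := f.apply_symm_apply t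

theorem inv_apply_eq_iff {f : ℝ ≃o ℝ} {s t : ℝ} : f⁻¹ s = t ↔ f t = s :=
  ⟨fun h => by rw [← h, apply_inv_self'], fun h => by rw [← h, inv_apply_self']⟩

/-- The map `t ↦ 2 ^ k * t + d`. -/
noncomputable def affIso (k : ℤ) (d : ℝ) : ℝ ≃o ℝ :=
  StrictMono.orderIsoOfRightInverse (fun t => 2 ^ k * t + d)
    (fun x y h => by
      have := mul_lt_mul_of_pos_left h (two_zpow_pos k)
      simp only; linarith)
    (fun t => (t - d) / 2 ^ k)
    (fun t => by have := (two_zpow_pos k).ne'; field_simp; ring)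

@[simp] theorem affIso_apply (k : ℤ) (d t : ℝ) : affIso k d t = 2 ^ k * t + d := rfl

theorem affIso_mem (k : ℤ) {d : ℝ} (hd : IsDyadic d) : affIso k d ∈ locPL :=
  fun x => (DyadicAffine.mk k hd).locPLAt x

/-! ### Glueing -/

theorem glue_strictMono {f g : ℝ → ℝ} (hf : StrictMono f) (hg : StrictMono g) {c : ℝ}
    (h : f c = g c) : StrictMono fun t => if t ≤ c then f t else g t := by
  intro x y hxy
  by_cases hx : x ≤ c <;> by_cases hy : y ≤ c
  · simpa [hx, hy] using hf hxy
  · simp only [hx, hy, if_true, if_false]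
    calc f x ≤ f c := hf.monotone hx
      _ = g c := h
      _ < g y := hg (not_le.1 hy)
  · exact absurd (hxy.le.trans hy) hx
  · simpa [hx, hy] using hg hxy

theorem glue_surjective (f g : ℝ ≃o ℝ) {c : ℝ} (h : f c = g c) :
    Function.Surjective fun t => if t ≤ c then f t else g t := by
  intro y
  by_cases hy : y ≤ f c
  · refine ⟨f.symm y, ?_⟩
    have : f.symm y ≤ c := by rwa [f.symm_apply_le]
    simp [this]
  · refine ⟨g.symm y, ?_⟩
    have : ¬ g.symm y ≤ c := by rwa [g.symm_apply_le, ← h]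
    simp [this]

/-- The map equal to `f` on the left of `c` and to `g` on the right of `c`. -/
noncomputable def glue (c : ℝ) (f g : ℝ ≃o ℝ) (h : f c = g c) : ℝ ≃o ℝ :=
  StrictMono.orderIsoOfSurjective _ (glue_strictMono f.strictMono g.strictMono h)
    (glue_surjective f g h)

section glue

variable {c : ℝ} {f g : ℝ ≃o ℝ} (h : f c = g c)

theorem glue_apply (t : ℝ) : glue c f g h t = if t ≤ c then f t else g t := rfl

theorem glue_of_le {t : ℝ} (ht : t ≤ c) : glue c f g h t = f t := by
  rw [glue_apply, if_pos ht]

theorem glue_of_ge {t : ℝ} (ht : c ≤ t) : glue c f g h t = g t := by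
  rcases ht.eq_or_lt with rfl | ht
  · rw [glue_of_le h le_rfl, h]
  · rw [glue_apply, if_neg (not_le.2 ht)]

theorem glue_mem (hc : IsDyadic c) (hf : f ∈ locPL) (hg : g ∈ locPL) : glue c f g h ∈ locPL := by
  intro x
  rcases lt_trichotomy x c with hx | rfl | hx
  · refine (hf x).congr ?_
    filter_upwards [Iio_mem_nhds hx] with t ht using glue_of_le h (le_of_lt ht)
  · refine ⟨(hg x).right.congr ?_, (hf x).left.congr ?_, fun h => absurd hc h⟩
    · filter_upwards [self_mem_nhdsWithin] with t ht using glue_of_ge h ht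
    · filter_upwards [self_mem_nhdsWithin] with t ht using glue_of_le h ht
  · refine (hg x).congr ?_
    filter_upwards [Ioi_mem_nhds hx] with t ht using glue_of_ge h (le_of_lt ht)

end glue

/-! ### Dilations and transitivity on pairs of dyadic points -/

/-- The identity on the left of `c`, slope `2` on `[c, c + 1]`, a translation on the right. -/
noncomputable def dilate (c : ℝ) : ℝ ≃o ℝ :=
  glue c 1 (glue (c + 1) (affIso 1 (-c)) (affIso 0 1) (by simp; ring)) (by
    rw [glue_of_le _ (by linarith)]; simp; ring)

theorem dilate_of_le {c t : ℝ} (h : t ≤ c) : dilate c t = t := by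
  rw [dilate, glue_of_le _ h]; rfl

theorem dilate_mid {c t : ℝ} (h : c ≤ t) (h' : t ≤ c + 1) : dilate c t = 2 * t - c := by
  rw [dilate, glue_of_ge _ h, glue_of_le _ h']; simp; ring

theorem dilate_of_ge {c t : ℝ} (h : c + 1 ≤ t) : dilate c t = t + 1 := by
  rw [dilate, glue_of_ge _ (by linarith), glue_of_ge _ h]; simp

theorem dilate_mem {c : ℝ} (hc : IsDyadic c) : dilate c ∈ locPL :=
  glue_mem _ hc (one_mem _) (glue_mem _ (hc.add isDyadic_one) (affIso_mem _ hc.neg)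
    (affIso_mem _ isDyadic_one))

theorem dilate_pow_of_ge {c t : ℝ} (h : c + 1 ≤ t) (n : ℕ) : (dilate c ^ n) t = t + n := by
  induction n with
  | zero => simp
  | succ n ih =>
    rw [pow_succ', RelIso.mul_apply, ih, dilate_of_ge]
    · push_cast; ring
    · have : (0 : ℝ) ≤ n := n.cast_nonneg
      linarith

theorem dilate_pow_of_le {c t : ℝ} (h : t ≤ c) (n : ℕ) : (dilate c ^ n) t = t := by
  induction n with
  | zero => simp
  | succ n ih => rw [pow_succ', RelIso.mul_apply, ih, dilate_of_le h]

/-- `dilate 0` adds `1` to every point of `[1, ∞)`, so iterating it raises a positive integer to any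
larger one; inverses lower it. -/
theorem exists_map_nat {M N : ℕ} (hM : 1 ≤ M) (hN : 1 ≤ N) :
    ∃ h ∈ locPL, h 0 = 0 ∧ h (M : ℝ) = N := by
  have key : ∀ M N : ℕ, 1 ≤ M → M ≤ N → ∃ h ∈ locPL, h 0 = 0 ∧ h (M : ℝ) = N := by
    intro M N hM h
    refine ⟨dilate 0 ^ (N - M), pow_mem (dilate_mem isDyadic_zero) _,
      dilate_pow_of_le le_rfl _, ?_⟩
    rw [dilate_pow_of_ge]
    · push_cast [h]; ring
    · simpa using hM
  rcases le_total M N with h | h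
  · exact key M N hM h
  · obtain ⟨f, hf, h0, h1⟩ := key N M hN h
    refine ⟨f⁻¹, inv_mem hf, ?_, ?_⟩
    · rwa [inv_apply_eq_iff]
    · rwa [inv_apply_eq_iff]

theorem exists_map_pair {a b a' b' : ℝ} (ha : IsDyadic a) (hb : IsDyadic b) (ha' : IsDyadic a')
    (hb' : IsDyadic b') (h : a < b) (h' : a' < b') : ∃ f ∈ locPL, f a = a' ∧ f b = b' := by
  have key : ∀ a b : ℝ, IsDyadic a → IsDyadic b → a < b → ∃ (M n : ℕ), 1 ≤ M ∧
      b - a = M / 2 ^ n := by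
    intro a b ha hb h
    obtain ⟨z, n, hz⟩ := isDyadic_sub hb ha
    have : (0 : ℝ) < z := by
      have h1 : (0 : ℝ) < z / 2 ^ n := by rw [← hz]; linarith
      exact (div_pos_iff_of_pos_right (by positivity)).1 h1
    have hz0 : 0 < z := by exact_mod_cast this
    lift z to ℕ using hz0.le
    exact ⟨z, n, by omega, by simpa using hz⟩
  obtain ⟨M, n, hM, hMn⟩ := key a b ha hb h
  obtain ⟨N, m, hN, hNm⟩ := key a' b' ha' hb' h'
  obtain ⟨f, hf, h0, h1⟩ := exists_map_nat hM hN
  -- Translate `a` to `0`, scale the length `M / 2 ^ n` up to the integer `M`, map `M` to `N`, then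
  -- scale back by `2 ^ (-m)` and translate to `a'`.
  refine ⟨affIso (-(m : ℤ)) a' * f * affIso n 0 * affIso 0 (-a), ?_, ?_, ?_⟩
  · exact mul_mem (mul_mem (mul_mem (affIso_mem _ ha') hf) (affIso_mem _ isDyadic_zero))
      (affIso_mem _ ha.neg)
  · simp [h0]
  · have e : (2 : ℝ) ^ n * (b - a) = M := by rw [hMn]; field_simp
    have e' : ((2 : ℝ) ^ m)⁻¹ * N = b' - a' := by rw [hNm]; field_simp
    simp only [RelIso.mul_apply, affIso_apply, zpow_zero, one_mul, zpow_natCast, add_zero,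
      ← sub_eq_add_neg, e, h1, zpow_neg, e']
    ring

/-- Any locally piecewise linear map can be bent to the identity on the right. -/
theorem exists_bend_right {f : ℝ ≃o ℝ} (hf : f ∈ locPL) {c d b : ℝ} (hc : IsDyadic c)
    (hb : IsDyadic b) (h : c < b) (h' : f c < b) (hd : d ≤ c) :
    ∃ g ∈ locPL, (∀ t ≤ d, g t = f t) ∧ ∀ t, b ≤ t → g t = t := by
  -- `k` carries `[c, b]` onto `[f c, b]` and so bridges `f` and the identity.
  obtain ⟨k, hk, k1, k2⟩ := exists_map_pair hc hb ((isDyadic_apply_iff hf c).2 hc) hb h h'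
  replace k2 : k b = (1 : ℝ ≃o ℝ) b := k2
  refine ⟨glue c f (glue b k 1 k2) (by rw [glue_of_le _ h.le, k1]),
    glue_mem _ hc hf (glue_mem _ hb hk (one_mem _)), fun t ht => ?_, fun t ht => ?_⟩
  · rw [glue_of_le _ (ht.trans hd)]
  · rw [glue_of_ge _ (h.le.trans ht), glue_of_ge _ ht]; rfl

/-- Any locally piecewise linear map can be bent to the identity on the left. -/
theorem exists_bend_left {f : ℝ ≃o ℝ} (hf : f ∈ locPL) {c d a : ℝ} (hc : IsDyadic c)
    (ha : IsDyadic a) (h : a < c) (h' : a < f c) (hd : c ≤ d) :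
    ∃ g ∈ locPL, (∀ t, d ≤ t → g t = f t) ∧ ∀ t ≤ a, g t = t := by
  obtain ⟨k, hk, k1, k2⟩ := exists_map_pair ha hc ha ((isDyadic_apply_iff hf c).2 hc) h h'
  refine ⟨glue a 1 (glue c k f k2) (by rw [glue_of_le _ h.le, k1]; rfl),
    glue_mem _ ha (one_mem _) (glue_mem _ hc hk hf), fun t ht => ?_, fun t ht => ?_⟩
  · rw [glue_of_ge _ (h.le.trans (hd.trans ht)), glue_of_ge _ (hd.trans ht)]
  · rw [glue_of_le _ ht]; rfl

/-! ### Compactly supported maps -/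

/-- The elements of `locPL` that are supported in a compact subset of `S`. -/
def compactSupp (S : Set ℝ) : Subgroup (ℝ ≃o ℝ) where
  carrier := {f | f ∈ locPL ∧ ∃ K, IsCompact K ∧ K ⊆ S ∧ ∀ t ∉ K, f t = t}
  one_mem' := ⟨one_mem _, ∅, isCompact_empty, empty_subset _, fun _ _ => rfl⟩
  mul_mem' := fun {f g} ⟨hf, K, hK, hKS, h⟩ ⟨hg, K', hK', hKS', h'⟩ =>
    ⟨mul_mem hf hg, K ∪ K', hK.union hK', union_subset hKS hKS', fun t ht => by
      rw [mem_union, not_or] at ht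
      rw [RelIso.mul_apply, h' t ht.2, h t ht.1]⟩
  inv_mem' := fun {f} ⟨hf, K, hK, hKS, h⟩ =>
    ⟨inv_mem hf, K, hK, hKS, fun t ht => inv_apply_eq_iff.2 (h t ht)⟩

theorem compactSupp_mono {S S' : Set ℝ} (h : S ⊆ S') : compactSupp S ≤ compactSupp S' :=
  fun _ ⟨hf, K, hK, hKS, hh⟩ => ⟨hf, K, hK, hKS.trans h, hh⟩

theorem apply_eq_of_mem_compactSupp {S : Set ℝ} {f : ℝ ≃o ℝ} (hf : f ∈ compactSupp S) {t : ℝ}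
    (ht : t ∉ S) : f t = t := by
  obtain ⟨-, K, -, hKS, h⟩ := hf
  exact h t fun hh => ht (hKS hh)

/-! ### Conjugation by an order embedding with convex range -/

open Classical in
/-- Transport of a self-map of the line along an embedding `φ`, extended by the identity. -/
noncomputable def conjFun (φ : ℝ → ℝ) (f : ℝ → ℝ) (t : ℝ) : ℝ :=
  if t ∈ range φ then φ (f (Function.invFun φ t)) else t

section conj

variable {φ : ℝ → ℝ} (hφ : StrictMono φ) (hr : (range φ).OrdConnected)

include hφ in
theorem invFun_apply (t : ℝ) : Function.invFun φ (φ t) = t :=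
  Function.leftInverse_invFun hφ.injective t

include hφ in
theorem conjFun_apply (f : ℝ → ℝ) (t : ℝ) : conjFun φ f (φ t) = φ (f t) := by
  rw [conjFun, if_pos (mem_range_self t), invFun_apply hφ]

theorem conjFun_of_notMem (f : ℝ → ℝ) {t : ℝ} (ht : t ∉ range φ) : conjFun φ f t = t := by
  rw [conjFun, if_neg ht]

include hφ in
theorem conjFun_comp (f g : ℝ → ℝ) (t : ℝ) :
    conjFun φ (fun t => f (g t)) t = conjFun φ f (conjFun φ g t) := by
  by_cases ht : t ∈ range φ
  · obtain ⟨s, rfl⟩ := ht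
    simp only [conjFun_apply hφ]
  · simp only [conjFun_of_notMem _ ht]

theorem conjFun_id (t : ℝ) : conjFun φ (fun t => t) t = t := by
  by_cases ht : t ∈ range φ
  · rw [conjFun, if_pos ht, Function.invFun_eq ht]
  · exact conjFun_of_notMem _ ht

include hφ hr in
theorem conjFun_strictMono {f : ℝ → ℝ} (hf : StrictMono f) : StrictMono (conjFun φ f) := by
  intro x y hxy
  by_cases hx : x ∈ range φ <;> by_cases hy : y ∈ range φ
  · obtain ⟨s, rfl⟩ := hx
    obtain ⟨t, rfl⟩ := hy
    rw [conjFun_apply hφ, conjFun_apply hφ]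
    exact hφ (hf (hφ.lt_iff_lt.1 hxy))
  · obtain ⟨s, rfl⟩ := hx
    rw [conjFun_apply hφ, conjFun_of_notMem _ hy]
    by_contra h
    exact hy (hr.out (mem_range_self s) (mem_range_self _) ⟨hxy.le, not_lt.1 h⟩)
  · obtain ⟨t, rfl⟩ := hy
    rw [conjFun_apply hφ, conjFun_of_notMem _ hx]
    by_contra h
    exact hx (hr.out (mem_range_self _) (mem_range_self t) ⟨not_lt.1 h, hxy.le⟩)
  · rwa [conjFun_of_notMem _ hx, conjFun_of_notMem _ hy]

/-- Conjugation by an order embedding `φ` of the line with convex range. -/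
noncomputable def conjHom : (ℝ ≃o ℝ) →* (ℝ ≃o ℝ) where
  toFun f := StrictMono.orderIsoOfRightInverse (conjFun φ f)
    (conjFun_strictMono hφ hr f.strictMono) (conjFun φ f.symm) (fun t => by
      rw [← conjFun_comp hφ]
      simp only [f.apply_symm_apply, conjFun_id])
  map_one' := by
    ext t
    exact conjFun_id t
  map_mul' f g := by
    ext t
    exact conjFun_comp hφ f g t

theorem conjHom_coe (f : ℝ ≃o ℝ) : ⇑(conjHom hφ hr f) = conjFun φ f := rfl

theorem conjHom_apply (f : ℝ ≃o ℝ) (t : ℝ) : conjHom hφ hr f (φ t) = φ (f t) :=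
  conjFun_apply hφ f t

theorem conjHom_of_notMem (f : ℝ ≃o ℝ) {t : ℝ} (ht : t ∉ range φ) : conjHom hφ hr f t = t :=
  conjFun_of_notMem f ht

theorem conjHom_injective : Function.Injective (conjHom hφ hr) := by
  intro f g h
  ext t
  apply hφ.injective
  rw [← conjHom_apply hφ hr, h, conjHom_apply]

variable (hPL : ∀ x, LocPLAt φ x) (ho : IsOpen (range φ))

include hPL ho in
theorem conjHom_locPLAt {f : ℝ ≃o ℝ} (hf : f ∈ locPL) {t : ℝ} (ht : t ∈ range φ) :
    LocPLAt (conjHom hφ hr f) t := by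
  obtain ⟨s, rfl⟩ := ht
  have h1 : LocPLAt (Function.invFun φ) (φ s) := (hPL s).leftInverse (invFun_apply hφ)
  have h2 : LocPLAt (fun t => f (Function.invFun φ t)) (φ s) := (hf _).comp h1
  refine ((hPL _).comp h2).congr ?_
  filter_upwards [ho.mem_nhds (mem_range_self s)] with t ht
  rw [conjHom_coe, conjFun, if_pos ht]

include hPL ho in
-- The image of the compact support is closed in the line, so the extension by the identity is
-- trivial near every point outside `range φ`. This is why nothing is required of `φ` near the ends
-- of its range, which may be irrational and may be limits of breaks.
theorem conjHom_mem {f : ℝ ≃o ℝ} (hf : f ∈ compactSupp univ) :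
    conjHom hφ hr f ∈ compactSupp (range φ) := by
  obtain ⟨hf, K, hK, -, h⟩ := hf
  have hc : Continuous φ := continuous_iff_continuousAt.2 fun x => (hPL x).continuousAt
  have hi : ∀ t ∉ φ '' K, conjHom hφ hr f t = t := by
    intro t ht
    by_cases hr' : t ∈ range φ
    · obtain ⟨s, rfl⟩ := hr'
      rw [conjHom_apply, h s fun hs => ht (mem_image_of_mem _ hs)]
    · exact conjHom_of_notMem hφ hr f hr'
  refine ⟨fun t => ?_, φ '' K, hK.image hc, image_subset_range _ _, hi⟩
  by_cases ht : t ∈ range φ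
  · exact conjHom_locPLAt hφ hr hPL ho hf ht
  · refine (DyadicAffine.id.locPLAt t).congr ?_
    have : (φ '' K)ᶜ ∈ 𝓝 t := (hK.image hc).isClosed.isOpen_compl.mem_nhds
      fun h => ht (image_subset_range _ _ h)
    filter_upwards [this] with s hs using hi s hs

include hPL in
theorem exists_conjHom_eq {g : ℝ ≃o ℝ} (hg : g ∈ compactSupp (range φ)) :
    ∃ f ∈ compactSupp univ, conjHom hφ hr f = g := by
  have key : ∀ g ∈ compactSupp (range φ), ∀ t, φ (Function.invFun φ (g (φ t))) = g (φ t) := by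
    intro g hg t
    refine Function.invFun_eq (f := φ) ?_
    by_contra hn
    have h1 := apply_eq_of_mem_compactSupp hg hn
    exact hn ⟨t, (g.injective h1).symm⟩
  have hm : StrictMono fun t => Function.invFun φ (g (φ t)) := by
    intro x y hxy
    rw [← hφ.lt_iff_lt]
    simp only [key g hg]
    exact g.strictMono (hφ hxy)
  let f : ℝ ≃o ℝ := hm.orderIsoOfRightInverse _ (fun t => Function.invFun φ (g⁻¹ (φ t)))
    (fun t => by
      simp only [key _ (inv_mem hg), apply_inv_self', invFun_apply hφ])
  have hf : ∀ t, f t = Function.invFun φ (g (φ t)) := fun _ => rfl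
  obtain ⟨hgL, K, hK, hKS, hgK⟩ := id hg
  refine ⟨f, ⟨fun x => ?_, Function.invFun φ '' K, ?_, subset_univ _, fun t ht => ?_⟩, ?_⟩
  · have h1 : LocPLAt (fun t => g (φ t)) x := (hgL _).comp (hPL x)
    refine LocPLAt.comp (g := Function.invFun φ) ?_ h1
    rw [← key g hg]
    exact (hPL _).leftInverse (invFun_apply hφ)
  · refine hK.image_of_continuousOn fun t ht => ContinuousAt.continuousWithinAt ?_
    obtain ⟨s, rfl⟩ := hKS ht
    exact ((hPL s).leftInverse (invFun_apply hφ)).continuousAt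
  · rw [hf, hgK, invFun_apply hφ]
    exact fun h => ht ⟨_, h, invFun_apply hφ t⟩
  · ext t
    by_cases ht : t ∈ range φ
    · obtain ⟨s, rfl⟩ := ht
      rw [conjHom_apply, hf, key g hg]
    · rw [conjHom_of_notMem _ _ _ ht, apply_eq_of_mem_compactSupp hg ht]

/-- Conjugation by `φ` identifies the compactly supported groups of the line and of `range φ`. -/
noncomputable def compactSuppEquiv : compactSupp univ ≃* compactSupp (range φ) :=
  MulEquiv.ofBijective
    (((conjHom hφ hr).comp (compactSupp univ).subtype).codRestrict (compactSupp (range φ))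
      fun f => conjHom_mem hφ hr hPL ho f.2)
    ⟨fun f g h => Subtype.ext (conjHom_injective hφ hr (congrArg Subtype.val h)), fun g => by
      obtain ⟨f, hf, h⟩ := exists_conjHom_eq hφ hr hPL g.2
      exact ⟨⟨f, hf⟩, Subtype.ext h⟩⟩

end conj

/-! ### Maps that are affine between consecutive integers -/

/-- The map sending `j` to `a j`, with slope `2 ^ k j` on `[j, j + 1]`. -/
noncomputable def stairs (a : ℤ → ℝ) (k : ℤ → ℤ) (t : ℝ) : ℝ :=
  2 ^ k ⌊t⌋ * (t - ⌊t⌋) + a ⌊t⌋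

section stairs

variable {a : ℤ → ℝ} {k : ℤ → ℤ} (ha : ∀ j, a (j + 1) = a j + 2 ^ k j)

include ha in
theorem stairs_of_mem {j : ℤ} {t : ℝ} (h1 : j ≤ t) (h2 : t ≤ j + 1) :
    stairs a k t = 2 ^ k j * (t - j) + a j := by
  rcases h2.lt_or_eq with h2 | rfl
  · rw [stairs, Int.floor_eq_iff.2 ⟨h1, h2⟩]
  · have : ⌊(j + 1 : ℝ)⌋ = j + 1 := by exact_mod_cast Int.floor_intCast (R := ℝ) (j + 1)
    rw [stairs, this, ha]
    push_cast; ring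

include ha in
theorem stairs_intCast (j : ℤ) : stairs a k j = a j := by
  rw [stairs_of_mem ha le_rfl (by linarith)]; simp

include ha in
theorem stairs_index_strictMono : StrictMono a := by
  refine strictMono_int_of_lt_succ fun j => ?_
  have := two_zpow_pos (k j)
  rw [ha]; linarith

theorem le_stairs (t : ℝ) : a ⌊t⌋ ≤ stairs a k t := by
  have := mul_nonneg (two_zpow_pos (k ⌊t⌋)).le (sub_nonneg.2 (Int.floor_le t))
  rw [stairs]; linarith

include ha in
theorem stairs_lt (t : ℝ) : stairs a k t < a (⌊t⌋ + 1) := by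
  have h : t - ⌊t⌋ < 1 := by have := Int.lt_floor_add_one t; linarith
  have := mul_lt_mul_of_pos_left h (two_zpow_pos (k ⌊t⌋))
  rw [stairs, ha]; linarith

include ha in
theorem stairs_strictMono : StrictMono (stairs a k) := by
  intro x y hxy
  rcases (Int.floor_mono hxy.le).eq_or_lt with h | h
  · rw [stairs, stairs, h]
    have := mul_lt_mul_of_pos_left (sub_lt_sub_right hxy (⌊y⌋ : ℝ)) (two_zpow_pos (k ⌊y⌋))
    linarith
  · calc stairs a k x < a (⌊x⌋ + 1) := stairs_lt ha x
      _ ≤ a ⌊y⌋ := (stairs_index_strictMono ha).monotone h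
      _ ≤ stairs a k y := le_stairs y

include ha in
theorem stairs_locPLAt (hd : IsDyadic (a 0)) (x : ℝ) : LocPLAt (stairs a k) x := by
  have hd' : ∀ j, IsDyadic (a j) := by
    intro j
    induction j with
    | zero => exact hd
    | succ i ih => rw [ha]; exact ih.add (isDyadic_zpow _)
    | pred i ih =>
      have h := ha (-(i : ℤ) - 1)
      rw [sub_add_cancel] at h
      rw [eq_sub_of_add_eq h.symm]
      exact isDyadic_sub ih (isDyadic_zpow _)
  have hA : ∀ j, DyadicAffine fun t => 2 ^ k j * (t - j) + a j := fun j =>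
    ⟨k j, a j + -(2 ^ k j * j), (hd' j).add ((isDyadic_intCast j).zpow_mul _).neg,
      fun t => by ring⟩
  have hr : Icc (⌊x⌋ : ℝ) (⌊x⌋ + 1) ∈ 𝓝[≥] x := by
    filter_upwards [self_mem_nhdsWithin,
      nhdsWithin_le_nhds (Iio_mem_nhds (Int.lt_floor_add_one x))] with t h1 h2
    exact ⟨(Int.floor_le x).trans h1, h2.le⟩
  have hright : AffineAlong (𝓝[≥] x) (stairs a k) := by
    refine ⟨_, hA ⌊x⌋, ?_⟩
    filter_upwards [hr] with t ht using stairs_of_mem ha ht.1 ht.2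
  rcases (Int.floor_le x).eq_or_lt with h | h
  · refine ⟨hright, ⟨_, hA (⌊x⌋ - 1), ?_⟩, fun hx => absurd (h ▸ isDyadic_intCast _) hx⟩
    have : x - 1 < x := by linarith
    filter_upwards [self_mem_nhdsWithin, nhdsWithin_le_nhds (Ioi_mem_nhds this)] with t h1 h2
    simp only [mem_Iic, mem_Ioi] at h1 h2
    refine stairs_of_mem ha ?_ ?_
    · push_cast; linarith
    · push_cast; linarith
  · refine AffineAlong.locPLAt ⟨_, hA ⌊x⌋, ?_⟩
    filter_upwards [Ioo_mem_nhds h (Int.lt_floor_add_one x)] with t ht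
      using stairs_of_mem ha ht.1.le ht.2.le

include ha in
theorem range_stairs {S : Set ℝ} (hS : S.OrdConnected) (h : ∀ j, a j ∈ S)
    (h1 : ∀ y ∈ S, ∃ i, a i ≤ y) (h2 : ∀ y ∈ S, ∃ i, y < a i) : range (stairs a k) = S := by
  ext y
  constructor
  · rintro ⟨t, rfl⟩
    exact hS.out (h _) (h _) ⟨le_stairs t, (stairs_lt ha t).le⟩
  · intro hy
    obtain ⟨j, hj⟩ := h2 y hy
    obtain ⟨i, hi, hmax⟩ := Int.exists_greatest_of_bdd (P := fun i => a i ≤ y)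
      ⟨j, fun z hz => ((stairs_index_strictMono ha).lt_iff_lt.1 (hz.trans_lt hj)).le⟩ (h1 y hy)
    have hlt : y < a i + 2 ^ k i := by
      rw [← ha]
      by_contra hn
      have := hmax (i + 1) (not_lt.1 hn)
      omega
    have hp := two_zpow_pos (k i)
    refine ⟨i + (y - a i) / 2 ^ k i, ?_⟩
    rw [stairs_of_mem ha (j := i)]
    · field_simp; ring
    · have : 0 ≤ (y - a i) / 2 ^ k i := div_nonneg (by linarith) hp.le
      linarith
    · have : (y - a i) / 2 ^ k i ≤ 1 := (div_le_one hp).2 (by linarith)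
      linarith

end stairs

/-! ### Piecewise linear parametrizations of intervals by the line -/

/-- Every positive real number is exhausted by a sequence of powers of two. -/
theorem exists_remainders {δ : ℝ} (hδ : 0 < δ) : ∃ r : ℕ → ℝ, r 0 = δ ∧ (∀ n, 0 < r n) ∧
    (∀ n, ∃ k : ℤ, r n = r (n + 1) + 2 ^ k) ∧ ∀ ε > 0, ∃ n, r n < ε := by
  have step : ∀ r : {r : ℝ // 0 < r}, ∃ r' : {r : ℝ // 0 < r},
      (∃ k : ℤ, (r : ℝ) = r' + 2 ^ k) ∧ (r' : ℝ) ≤ r / 2 := by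
    rintro ⟨r, hr⟩
    -- The inequality `2 ^ k < r` is strict, so the remainder stays positive even when `r` is itself
    -- a power of two; `r ≤ 2 ^ (k + 1)` makes it at most half of `r`.
    obtain ⟨k, h1, h2⟩ := exists_mem_Ioc_zpow hr (one_lt_two (α := ℝ))
    rw [zpow_add_one₀ two_ne_zero] at h2
    exact ⟨⟨r - 2 ^ k, sub_pos.2 h1⟩, ⟨k, by simp⟩, by simp only; linarith⟩
  choose F hF using step
  let r : ℕ → ℝ := fun n => (F^[n] ⟨δ, hδ⟩ : {r : ℝ // 0 < r})
  have hsucc : ∀ n, r (n + 1) = F (F^[n] ⟨δ, hδ⟩) := fun n => by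
    simp only [r, Function.iterate_succ_apply']
  refine ⟨r, rfl, fun n => (F^[n] _).2, fun n => ?_, fun ε hε => ?_⟩
  · rw [hsucc]; exact (hF _).1
  · have hle : ∀ n, r n ≤ δ * (1 / 2) ^ n := by
      intro n
      induction n with
      | zero => simp [r]
      | succ n ih =>
        rw [hsucc, pow_succ]
        have : ((F (F^[n] ⟨δ, hδ⟩) : {r : ℝ // 0 < r}) : ℝ) ≤ r n / 2 := (hF _).2
        linarith
    obtain ⟨n, hn⟩ := exists_pow_lt_of_lt_one (div_pos hε hδ) (by norm_num : (1 / 2 : ℝ) < 1)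
    refine ⟨n, (hle n).trans_lt ?_⟩
    rwa [lt_div_iff₀ hδ, mul_comm] at hn

/-- Start at a dyadic interior point and take steps whose lengths are powers of two, summing to the
distance to `b` on one side and to `a` on the other. All the nodes are dyadic although `a` and `b`
need not be. -/
theorem exists_stairs_Ioo {a b : ℝ} (hab : a < b) : ∃ φ : ℝ → ℝ, StrictMono φ ∧
    (∀ x, LocPLAt φ x) ∧ range φ = Ioo a b := by
  obtain ⟨c, hc, h1, h2⟩ := exists_dyadic_btwn hab
  obtain ⟨r, r0, rpos, rs, rlim⟩ := exists_remainders (sub_pos.2 h2)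
  obtain ⟨q, q0, qpos, qs, qlim⟩ := exists_remainders (sub_pos.2 h1)
  have rmem : ∀ n, r n ≤ b - c := by
    intro n
    induction n with
    | zero => exact r0.le
    | succ n ih =>
      obtain ⟨k, hk⟩ := rs n
      have := two_zpow_pos k
      linarith
  have qmem : ∀ n, q n ≤ c - a := by
    intro n
    induction n with
    | zero => exact q0.le
    | succ n ih =>
      obtain ⟨k, hk⟩ := qs n
      have := two_zpow_pos k
      linarith
  -- The two sequences meet at `p 0 = c`. Since `Int.negSucc n` is `-(n + 1)`, the remainder used
  -- there is `q (n + 1)`.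
  let p : ℤ → ℝ := fun j => match j with
    | Int.ofNat n => b - r n
    | Int.negSucc n => a + q (n + 1)
  have hp : ∀ j, ∃ k : ℤ, p (j + 1) = p j + 2 ^ k := by
    rintro (n | n)
    · obtain ⟨k, hk⟩ := rs n
      refine ⟨k, ?_⟩
      change b - r (n + 1) = b - r n + _
      linarith
    · obtain ⟨k, hk⟩ := qs n
      refine ⟨k, ?_⟩
      rcases n with _ | n
      · change b - r 0 = a + q 1 + _
        rw [r0]; rw [q0] at hk; linarith
      · change a + q (n + 1) = a + q (n + 1 + 1) + _
        linarith
  choose k hk using hp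
  have hp0 : p 0 = c := by change b - r 0 = c; rw [r0]; ring
  refine ⟨stairs p k, stairs_strictMono hk, stairs_locPLAt hk (hp0 ▸ hc),
    range_stairs hk ordConnected_Ioo ?_ ?_ ?_⟩
  · rintro (n | n)
    · have := rpos n; have := rmem n
      change b - r n ∈ Ioo a b
      constructor <;> linarith
    · have := qpos (n + 1); have := qmem (n + 1)
      change a + q (n + 1) ∈ Ioo a b
      constructor <;> linarith
  · intro y hy
    obtain ⟨n, hn⟩ := qlim (y - a) (sub_pos.2 hy.1)
    refine ⟨Int.negSucc n, ?_⟩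
    obtain ⟨k, hk⟩ := qs n
    have := two_zpow_pos k
    change a + q (n + 1) ≤ y
    linarith
  · intro y hy
    obtain ⟨n, hn⟩ := rlim (b - y) (sub_pos.2 hy.2)
    refine ⟨Int.ofNat n, ?_⟩
    change y < b - r n
    linarith

theorem nonempty_compactSupp_equiv_Ioo {a b : ℝ} (hab : a < b) :
    Nonempty (compactSupp univ ≃* compactSupp (Ioo a b)) := by
  obtain ⟨φ, h1, h2, h3⟩ := exists_stairs_Ioo hab
  rw [← h3]
  exact ⟨compactSuppEquiv h1 (h3 ▸ ordConnected_Ioo) h2 (h3 ▸ isOpen_Ioo)⟩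

/-! ### Break points -/

theorem LocPLAt.eventually_affineAlong {f : ℝ → ℝ} {x : ℝ} (h : LocPLAt f x) :
    ∀ᶠ t in 𝓝[≠] x, AffineAlong (𝓝 t) f := by
  rw [← nhdsLT_sup_nhdsGT, eventually_sup]
  constructor
  · obtain ⟨A, hA, h⟩ := h.left
    have h1 : ∀ᶠ t in 𝓝[<] x, f t = A t := h.filter_mono (nhdsWithin_mono _ Iio_subset_Iic_self)
    filter_upwards [eventually_eventually_nhdsWithin.2 h1, self_mem_nhdsWithin] with t h2 h3
    rw [isOpen_Iio.nhdsWithin_eq h3] at h2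
    exact ⟨A, hA, h2⟩
  · obtain ⟨A, hA, h⟩ := h.right
    have h1 : ∀ᶠ t in 𝓝[>] x, f t = A t := h.filter_mono (nhdsWithin_mono _ Ioi_subset_Ici_self)
    filter_upwards [eventually_eventually_nhdsWithin.2 h1, self_mem_nhdsWithin] with t h2 h3
    rw [isOpen_Ioi.nhdsWithin_eq h3] at h2
    exact ⟨A, hA, h2⟩

/-- Connectedness of the open interval: the set where `f` is locally equal to `A` is open, and also
closed in the interval, because two affine maps that agree on an open set coincide. -/
theorem exists_eqOn_Icc {f : ℝ → ℝ} (hc : Continuous f) {x y : ℝ} (hxy : x < y)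
    (h : ∀ t ∈ Ioo x y, AffineAlong (𝓝 t) f) : ∃ A, DyadicAffine A ∧ EqOn f A (Icc x y) := by
  obtain ⟨m, hm⟩ := nonempty_Ioo.2 hxy
  obtain ⟨A, hA, hmA⟩ := h m hm
  have hu : IsOpen {t | f =ᶠ[𝓝 t] A} := isOpen_setOfPred_eventually_nhds
  have hsub : Ioo x y ⊆ {t | f =ᶠ[𝓝 t] A} := by
    refine isPreconnected_Ioo.subset_of_closure_inter_subset hu ⟨m, hm, hmA⟩ ?_
    rintro t ⟨ht, htm⟩
    obtain ⟨B, hB, htB⟩ := h t htm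
    obtain ⟨s, hs1, hs2⟩ := mem_closure_iff_nhds.1 ht _ (eventually_eventually_nhds.2 htB)
    have hAB : A =ᶠ[𝓝 s] B := EventuallyEq.trans (EventuallyEq.symm hs2) hs1
    obtain ⟨s', h1, h2⟩ := ((hAB.filter_mono nhdsWithin_le_nhds).and
      (self_mem_nhdsWithin : ∀ᶠ z in 𝓝[>] s, z ∈ Ioi s)).exists
    have := hA.eq_of_eq_at_two hB (ne_of_gt h2) h1 hAB.eq_of_nhds
    rwa [mem_ofPred_eq, this]
  refine ⟨A, hA, ?_⟩
  rw [← closure_Ioo hxy.ne]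
  exact EqOn.closure (fun t ht => (hsub ht).eq_of_nhds) hc hA.continuous

/-- Every point has a punctured neighbourhood on which `f` is locally affine. By compactness only
finitely many points of `[a, b]` can fail to have an affine germ, and these are dyadic by
`LocPLAt.both`. -/
theorem exists_breaks {f : ℝ ≃o ℝ} (hf : f ∈ locPL) (a b : ℝ) : ∃ B : Finset ℝ,
    (∀ c ∈ B, IsDyadic c) ∧ ∀ x y, a ≤ x → x ≤ y → y ≤ b → (∀ c ∈ B, ¬ (x < c ∧ c < y)) →
      ∃ A, DyadicAffine A ∧ EqOn f A (Icc x y) := by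
  classical
  obtain ⟨T, -, hT⟩ := (isCompact_Icc (a := a) (b := b)).elim_nhds_subcover
    (fun x => {t | t ≠ x → AffineAlong (𝓝 t) f}) (fun x _ =>
      eventually_nhdsWithin_iff.1 (hf x).eventually_affineAlong)
  refine ⟨T.filter fun c => ¬ AffineAlong (𝓝 c) f, fun c hc => ?_, fun x y hax hxy hyb hB => ?_⟩
  · by_contra h
    exact (Finset.mem_filter.1 hc).2 ((hf c).both h)
  · rcases hxy.eq_or_lt with rfl | hlt
    · obtain ⟨A, hA, h⟩ := (hf x).right
      refine ⟨A, hA, fun t ht => ?_⟩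
      rw [Icc_self, mem_singleton_iff] at ht
      rw [ht]
      exact h.eq_of_nhdsWithin self_mem_Ici
    · refine exists_eqOn_Icc f.continuous hlt fun t ht => ?_
      by_contra hn
      have hmem := hT (show t ∈ Icc a b from ⟨hax.trans ht.1.le, ht.2.le.trans hyb⟩)
      simp only [mem_iUnion] at hmem
      obtain ⟨c, hc, htc⟩ := hmem
      have : t = c := by
        by_contra hne
        exact hn (htc hne)
      subst this
      exact hB t (Finset.mem_filter.2 ⟨hc, hn⟩) ht

/-! ### Maps that are integral translations near infinity -/

/-- The elements of `locPL` that are trivial near `-∞` and integral translations near `∞`. -/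
def transAtTop : Subgroup (ℝ ≃o ℝ) where
  carrier := {f | f ∈ locPL ∧ (∀ᶠ t in atBot, f t = t) ∧ ∃ l : ℤ, ∀ᶠ t in atTop, f t = t + l}
  one_mem' := ⟨one_mem _, by simp, 0, by simp⟩
  mul_mem' := by
    rintro f g ⟨hf, hf1, l, hf2⟩ ⟨hg, hg1, l', hg2⟩
    refine ⟨mul_mem hf hg, ?_, l + l', ?_⟩
    · filter_upwards [hf1, hg1] with t h1 h2
      rw [RelIso.mul_apply, h2, h1]
    · filter_upwards [hg2, g.tendsto_atTop.eventually hf2] with t h1 h2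
      rw [RelIso.mul_apply, h2, h1]
      push_cast; ring
  inv_mem' := by
    rintro f ⟨hf, hf1, l, hf2⟩
    refine ⟨inv_mem hf, ?_, -l, ?_⟩
    · filter_upwards [hf1] with t h1 using inv_apply_eq_iff.2 h1
    · filter_upwards [(f⁻¹).tendsto_atTop.eventually hf2] with t h1
      rw [apply_inv_self'] at h1
      push_cast; linarith

theorem dilate_mem_transAtTop {c : ℝ} (hc : IsDyadic c) : dilate c ∈ transAtTop := by
  refine ⟨dilate_mem hc, ?_, 1, ?_⟩
  · filter_upwards [eventually_le_atBot c] with t ht using dilate_of_le ht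
  · filter_upwards [eventually_ge_atTop (c + 1)] with t ht
    rw [dilate_of_ge ht]; simp

theorem isDyadic_natCast (n : ℕ) : IsDyadic n := by exact_mod_cast isDyadic_intCast n

/-- The defining relation of `F`: `dilate (c - 1)` is translation by `1` on `[c, ∞)`, which contains
the support of `dilate c`, so conjugation shifts that support by `1`. -/
theorem dilate_relation (c : ℝ) :
    dilate (c - 1) * dilate c = dilate (c + 1) * dilate (c - 1) := by
  have hge : ∀ t, c ≤ t → dilate (c - 1) t = t + 1 := fun t ht => dilate_of_ge (by linarith)
  have hc : dilate c c = c := dilate_of_le le_rfl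
  ext t
  rw [RelIso.mul_apply, RelIso.mul_apply]
  rcases le_total t c with h | h
  · rw [dilate_of_le h]
    have h1 : dilate (c - 1) t ≤ c + 1 := by
      rw [← hge c le_rfl]; exact (dilate (c - 1)).monotone h
    rw [dilate_of_le h1]
  · have h1 : c ≤ dilate c t := by
      have := (dilate c).monotone h
      rwa [hc] at this
    rw [hge _ h1, hge _ h]
    rcases le_total t (c + 1) with h2 | h2
    · rw [dilate_mid h h2, dilate_mid (by linarith) (by linarith)]; ring
    · rw [dilate_of_ge h2, dilate_of_ge (by linarith)]

/-! ### Homomorphisms from `transAtTop` to abelian groups -/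

section character

variable {A : Type*} [CommGroup A] (χ : transAtTop →* A)

/-- The element `dilate n` of `transAtTop`. -/
noncomputable def dilateT (n : ℕ) : transAtTop :=
  ⟨dilate n, dilate_mem_transAtTop (isDyadic_natCast n)⟩

/-- Consecutive dilations are conjugate by `dilate_relation`, hence indistinguishable in an abelian
quotient. -/
theorem map_dilateT (n : ℕ) : χ (dilateT n) = χ (dilateT 0) := by
  induction n with
  | zero => rfl
  | succ n ih =>
    rw [← ih]
    let w : transAtTop := ⟨dilate ((n : ℝ) - 1),
      dilate_mem_transAtTop (isDyadic_sub (isDyadic_natCast n) isDyadic_one)⟩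
    have h : w * dilateT n = dilateT (n + 1) * w := by
      apply Subtype.ext
      have := dilate_relation (n : ℝ)
      simpa [w, dilateT] using this
    have h2 := congrArg χ h
    rw [map_mul, map_mul, mul_comm] at h2
    exact (mul_right_cancel h2).symm

/-- Self-maps of the line, trivial on the left of `0`, mapping each interval `[n, n + 1]` with
`0 ≤ n` onto a standard dyadic interval of length at most `1`. -/
structure Contracting (g : ℝ → ℝ) : Prop where
  fix : ∀ t ≤ 0, g t = t
  piece : ∀ i : ℕ, ∃ (e : ℕ) (z : ℤ), ∀ t, (i : ℝ) ≤ t → t ≤ i + 1 → g t = (z + (t - i)) / 2 ^ e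

theorem Contracting.map_add_one_le {g : ℝ → ℝ} (hg : Contracting g) (n : ℕ) :
    g (n + 1) ≤ g n + 1 := by
  obtain ⟨e, z, h⟩ := hg.piece n
  rw [h _ (by linarith) le_rfl, h _ le_rfl (by linarith), div_add' _ _ _ (by positivity)]
  have : (1 : ℝ) ≤ 2 ^ e := one_le_pow₀ (by norm_num)
  gcongr <;> linarith

theorem Contracting.map_add_le {g : ℝ → ℝ} (hg : Contracting g) (n k : ℕ) :
    g ((n + k : ℕ) : ℝ) ≤ g n + k := by
  induction k with
  | zero => simp
  | succ k ih =>
    have := hg.map_add_one_le (n + k)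
    push_cast at this ih ⊢
    rw [← add_assoc]
    linarith

theorem Contracting.eq_one {g : ℝ ≃o ℝ} (hg : Contracting g) (h : ∀ n : ℕ, g n = n) : g = 1 := by
  ext t
  rcases le_total t 0 with ht | ht
  · exact hg.fix t ht
  · obtain ⟨e, z, hp⟩ := hg.piece ⌊t⌋₊
    have h0 := hp _ le_rfl (by linarith)
    have h1 := hp _ (by linarith) le_rfl
    have h2 := hp t (Nat.floor_le ht) (Nat.lt_floor_add_one t).le
    rw [h] at h0
    have h3 := h (⌊t⌋₊ + 1)
    push_cast at h3
    rw [h3] at h1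
    have hpos : (2 : ℝ) ^ e ≠ 0 := by positivity
    rw [eq_div_iff hpos] at h0 h1
    have h4 : (2 : ℝ) ^ e = 1 := by linear_combination h1 - h0
    rw [h4] at h0 h2
    rw [h2, RelIso.one_apply]
    linarith

/-- Since unit steps never grow, `g n - n` is nonincreasing in `n`. It vanishes at `0` and far out,
hence everywhere, and a contracting map fixing all natural numbers is affine of slope `1` on each
piece. -/
theorem Contracting.eq_one_of_eventually {g : ℝ ≃o ℝ} (hg : Contracting g)
    (h : ∀ᶠ t in atTop, g t = t) : g = 1 := by
  refine hg.eq_one fun n => le_antisymm ?_ ?_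
  · have := hg.map_add_le 0 n
    simpa [hg.fix 0 le_rfl] using this
  · obtain ⟨N, h1, h2⟩ := ((tendsto_natCast_atTop_atTop.eventually h).and
      (eventually_ge_atTop n)).exists
    obtain ⟨k, rfl⟩ := Nat.exists_eq_add_of_le h2
    have := hg.map_add_le n k
    rw [h1] at this
    push_cast at this
    linarith

/-- Removes one bisection. The image intervals lying in `[j, j + 1]` properly subdivide it, so each
has length at most `1 / 2` and doubling keeps it a standard interval of length at most `1`. Those
further right are translated by `1`. -/
theorem Contracting.dilate_mul {g : ℝ ≃o ℝ} (hg : Contracting g) {j : ℕ} (hj : g j = j)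
    (hj' : g (j + 1) ≠ j + 1) : Contracting (dilate j * g : ℝ ≃o ℝ) := by
  have hj0 : (0 : ℝ) ≤ j := j.cast_nonneg
  constructor
  · intro t ht
    rw [RelIso.mul_apply, hg.fix t ht, dilate_of_le (ht.trans hj0)]
  · intro i
    obtain ⟨e, z, h⟩ := hg.piece i
    have hp : (0 : ℝ) < 2 ^ e := by positivity
    have hi := h i le_rfl (by linarith)
    rcases lt_or_ge i j with hij | hij
    · refine ⟨e, z, fun t h1 h2 => ?_⟩
      have h3 : t ≤ j := h2.trans (by exact_mod_cast hij)
      have h4 := g.monotone h3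
      rw [hj] at h4
      rw [RelIso.mul_apply, dilate_of_le h4, h t h1 h2]
    · have hz : (j : ℝ) * 2 ^ e ≤ z := by
        have := g.monotone (Nat.cast_le (α := ℝ).2 hij)
        rw [hj, hi, le_div_iff₀ hp] at this
        linarith
      rcases lt_or_ge z ((j + 1) * 2 ^ e) with hlt | hge
      · have hz1 : ((z : ℝ) + 1) ≤ (j + 1) * 2 ^ e := by exact_mod_cast hlt
        -- A unit interval starting in `[j, j + 1)` could only be `[j, j + 1]` itself, mapped from
        -- itself, against `hj'`.
        have he : e ≠ 0 := by
          rintro rfl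
          simp only [pow_zero, mul_one, div_one] at hz hz1 h
          have hzj : (z : ℝ) = j := by linarith
          have : g j = g i := by rw [hj, hi]; simp [hzj]
          have hij' : (j : ℝ) = i := g.injective this
          have h1 := h (i + 1) (by linarith) le_rfl
          apply hj'
          rw [hij', h1, hzj, hij']
          ring
        obtain ⟨e, rfl⟩ := Nat.exists_eq_succ_of_ne_zero he
        refine ⟨e, z - j * 2 ^ e, fun t h1 h2 => ?_⟩
        have hp' : (0 : ℝ) < 2 ^ e := by positivity
        rw [RelIso.mul_apply, dilate_mid, h t h1 h2]
        · push_cast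
          rw [pow_succ]
          field_simp
          ring
        · rw [h t h1 h2, le_div_iff₀ hp]; linarith
        · rw [h t h1 h2, div_le_iff₀ hp]; linarith
      · have hz1 : ((j : ℝ) + 1) * 2 ^ e ≤ z := by exact_mod_cast hge
        refine ⟨e, z + 2 ^ e, fun t h1 h2 => ?_⟩
        rw [RelIso.mul_apply, dilate_of_ge, h t h1 h2]
        · push_cast
          field_simp
          ring
        · rw [h t h1 h2, le_div_iff₀ hp]; linarith

/-- A contracting map that ends as translation by `-m` records `m` bisections. Undoing one at the
first unit interval that is not fixed costs one dilation, and all dilations have the same image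
under `χ`, so `χ g` depends on `m` alone. -/
theorem Contracting.map_mul_pow (m : ℕ) : ∀ (g : transAtTop),
    Contracting (g : ℝ ≃o ℝ) → (∀ᶠ t in atTop, (g : ℝ ≃o ℝ) t = t - m) →
      χ g * χ (dilateT 0) ^ m = 1 := by
  induction m with
  | zero =>
    intro g hg h
    have : g = 1 := Subtype.ext (hg.eq_one_of_eventually (by simpa using h))
    simp [this]
  | succ m ih =>
    intro g hg h
    have hex : ∃ n : ℕ, (g : ℝ ≃o ℝ) n ≠ n := by
      by_contra! hn
      obtain ⟨n, h1⟩ := (tendsto_natCast_atTop_atTop.eventually h).exists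
      rw [hn] at h1
      push_cast at h1
      have : (0 : ℝ) ≤ m := m.cast_nonneg
      linarith
    classical
    obtain ⟨j, hj⟩ : ∃ j, Nat.find hex = j + 1 := Nat.exists_eq_succ_of_ne_zero fun h0 => by
      have := Nat.find_spec hex
      rw [h0, Nat.cast_zero] at this
      exact this (hg.fix 0 le_rfl)
    have h1 : (g : ℝ ≃o ℝ) j = j := not_not.1 (Nat.find_min hex (by omega))
    have h2 : (g : ℝ ≃o ℝ) (j + 1) ≠ j + 1 := by
      have := Nat.find_spec hex
      rw [hj] at this
      exact_mod_cast this
    have := ih (dilateT j * g) (hg.dilate_mul h1 h2) (by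
      filter_upwards [h, eventually_ge_atTop ((j : ℝ) + 1 + (m + 1))] with t h3 h4
      change dilate j ((g : ℝ ≃o ℝ) t) = _
      rw [h3, dilate_of_ge]
      · push_cast; ring
      · push_cast; linarith)
    rw [map_mul, map_dilateT] at this
    rw [pow_succ', ← mul_assoc, mul_comm (χ g), this]

/-- With slope `2 ^ k` and constant `p / 2 ^ m`, a mesh `2 ^ (-n)` so fine that the image mesh `2 ^
(k - n)` divides `2 ^ (-m)` sends each grid interval to a standard dyadic one. -/
theorem DyadicAffine.eventually_standard {A : ℝ → ℝ} (hA : DyadicAffine A) :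
    ∀ᶠ n : ℕ in atTop, ∃ (e : ℕ) (z : ℤ), ∀ u, A (u / 2 ^ n) = (z + u) / 2 ^ e := by
  obtain ⟨k, d, ⟨p, m, rfl⟩, hA⟩ := hA
  filter_upwards [eventually_ge_atTop (k.natAbs + m)] with n hn
  obtain ⟨e, he⟩ : ∃ e : ℕ, (n : ℤ) - k = e + m := ⟨((n : ℤ) - k - m).toNat, by omega⟩
  refine ⟨e + m, p * 2 ^ e, fun u => ?_⟩
  have hk : (2 : ℝ) ^ k = 2 ^ n / 2 ^ (e + m) := by
    rw [show k = (n : ℤ) - ((e + m : ℕ) : ℤ) by push_cast; omega, zpow_sub₀ two_ne_zero,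
      zpow_natCast, zpow_natCast]
  rw [hA, hk]
  push_cast
  rw [pow_add]
  field_simp
  ring

/-- The map `t ↦ t / 2 ^ n` on `[0, 2 ^ n * b]`, extended by translations. -/
noncomputable def shrink (n b : ℕ) : ℝ ≃o ℝ :=
  glue 0 1 (glue (2 ^ n * b) (affIso (-(n : ℤ)) 0) (affIso 0 (b - 2 ^ n * b)) (by simp)) (by
    rw [glue_of_le _ (by positivity)]; simp)

theorem shrink_of_le {n b : ℕ} {t : ℝ} (h : t ≤ 0) : shrink n b t = t := by
  rw [shrink, glue_of_le _ h]; rfl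

theorem shrink_mid {n b : ℕ} {t : ℝ} (h : 0 ≤ t) (h' : t ≤ 2 ^ n * b) :
    shrink n b t = t / 2 ^ n := by
  rw [shrink, glue_of_ge _ h, glue_of_le _ h']
  simp [div_eq_inv_mul]

theorem shrink_of_ge {n b : ℕ} {t : ℝ} (h : 2 ^ n * b ≤ t) :
    shrink n b t = t + (b - 2 ^ n * b) := by
  have h0 : (0 : ℝ) ≤ 2 ^ n * b := by positivity
  rw [shrink, glue_of_ge _ (h0.trans h), glue_of_ge _ h]
  simp

theorem shrink_mem (n b : ℕ) : shrink n b ∈ transAtTop := by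
  have h : IsDyadic (2 ^ n * b : ℝ) := by exact_mod_cast isDyadic_natCast (2 ^ n * b)
  refine ⟨glue_mem _ isDyadic_zero (one_mem _) (glue_mem _ h (affIso_mem _ isDyadic_zero)
    (affIso_mem _ (isDyadic_sub (isDyadic_natCast b) h))), ?_, b - 2 ^ n * b, ?_⟩
  · filter_upwards [eventually_le_atBot 0] with t ht using shrink_of_le ht
  · filter_upwards [eventually_ge_atTop (2 ^ n * b : ℝ)] with t ht
    rw [shrink_of_ge ht]
    push_cast; rfl

theorem contracting_mul_shrink {f : ℝ ≃o ℝ} {n b : ℕ} (h0 : ∀ t ≤ 0, f t = t)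
    (hb : ∀ t, (b : ℝ) ≤ t → f t = t)
    (hn : ∀ j : ℕ, j < 2 ^ n * b → ∃ A, DyadicAffine A ∧
      EqOn f A (Icc (j / 2 ^ n) ((j + 1) / 2 ^ n)) ∧
      ∃ (e : ℕ) (z : ℤ), ∀ u, A (u / 2 ^ n) = (z + u) / 2 ^ e) :
    Contracting (f * shrink n b : ℝ ≃o ℝ) := by
  constructor
  · intro t ht
    rw [RelIso.mul_apply, shrink_of_le ht, h0 t ht]
  · intro i
    rcases lt_or_ge i (2 ^ n * b) with hi | hi
    · obtain ⟨A, -, hfA, e, z, h⟩ := hn i hi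
      have hi' : (i : ℝ) + 1 ≤ 2 ^ n * b := by exact_mod_cast hi
      refine ⟨e, z + i, fun t h1 h2 => ?_⟩
      have h3 : (0 : ℝ) ≤ i := i.cast_nonneg
      rw [RelIso.mul_apply, shrink_mid (h3.trans h1) (h2.trans hi'), hfA, h]
      · push_cast; ring
      · constructor <;> gcongr
    · have hi' : (2 ^ n * b : ℝ) ≤ i := by exact_mod_cast hi
      refine ⟨0, i + b - 2 ^ n * b, fun t h1 h2 => ?_⟩
      rw [RelIso.mul_apply, shrink_of_ge (hi'.trans h1), hb]
      · push_cast; ring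
      · linarith

/-- First a level `n₀` at which all break points lie on the grid, so each cell is affine; then a
finer level that serves all of the finitely many affine pieces at once. -/
theorem exists_standard_level {f : ℝ ≃o ℝ} (hf : f ∈ locPL) (b : ℕ) :
    ∃ n : ℕ, ∀ j : ℕ, j < 2 ^ n * b → ∃ A, DyadicAffine A ∧
      EqOn f A (Icc (j / 2 ^ n) ((j + 1) / 2 ^ n)) ∧
      ∃ (e : ℕ) (z : ℤ), ∀ u, A (u / 2 ^ n) = (z + u) / 2 ^ e := by
  obtain ⟨B, hB, h⟩ := exists_breaks hf 0 b
  obtain ⟨n₀, hn₀⟩ : ∃ n₀ : ℕ, ∀ c ∈ B, ∃ z : ℤ, c = z / 2 ^ n₀ := by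
    have : ∀ᶠ n₀ : ℕ in atTop, ∀ c ∈ B, ∃ z : ℤ, c = z / 2 ^ n₀ := by
      rw [eventually_all_finset]
      intro c hc
      obtain ⟨z, m, rfl⟩ := hB c hc
      filter_upwards [eventually_ge_atTop m] with n hn
      obtain ⟨k, rfl⟩ := Nat.exists_eq_add_of_le hn
      refine ⟨z * 2 ^ k, ?_⟩
      push_cast
      rw [pow_add]
      field_simp
    exact this.exists
  have hpiece : ∀ i : ℕ, i < 2 ^ n₀ * b → ∃ A, DyadicAffine A ∧
      EqOn f A (Icc (i / 2 ^ n₀) ((i + 1) / 2 ^ n₀)) := by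
    intro i hi
    have hi' : (i : ℝ) + 1 ≤ b * 2 ^ n₀ := by rw [mul_comm]; exact_mod_cast hi
    refine h _ _ (by positivity) (by gcongr; linarith) ?_ ?_
    · rwa [div_le_iff₀ (by positivity)]
    · rintro c hc ⟨h1, h2⟩
      obtain ⟨z, rfl⟩ := hn₀ c hc
      rw [div_lt_div_iff_of_pos_right (by positivity)] at h1 h2
      have h3 : (i : ℤ) < z := by exact_mod_cast h1
      have h4 : z < i + 1 := by exact_mod_cast h2
      omega
  choose! A hA hfA using hpiece
  have hlev : ∀ᶠ n : ℕ in atTop, ∀ i ∈ Finset.range (2 ^ n₀ * b),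
      ∃ (e : ℕ) (z : ℤ), ∀ u, A i (u / 2 ^ n) = (z + u) / 2 ^ e := by
    rw [eventually_all_finset]
    exact fun i hi => (hA i (Finset.mem_range.1 hi)).eventually_standard
  obtain ⟨n, hn, hle⟩ := (hlev.and (eventually_ge_atTop n₀)).exists
  obtain ⟨k, rfl⟩ := Nat.exists_eq_add_of_le hle
  refine ⟨n₀ + k, fun j hj => ?_⟩
  have hdiv : j / 2 ^ k < 2 ^ n₀ * b := by
    rw [Nat.div_lt_iff_lt_mul (by positivity)]
    calc j < 2 ^ (n₀ + k) * b := hj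
      _ = 2 ^ n₀ * b * 2 ^ k := by rw [pow_add]; ring
  -- The division is that of natural numbers: it finds the coarse cell of level `n₀` containing the
  -- fine cell `j`.
  refine ⟨A (j / 2 ^ k), hA _ hdiv, (hfA _ hdiv).mono ?_, hn _ (Finset.mem_range.2 hdiv)⟩
  have h1 : j / 2 ^ k * 2 ^ k ≤ j := Nat.div_mul_le_self _ _
  have h2 : j + 1 ≤ (j / 2 ^ k + 1) * 2 ^ k := by
    rw [add_mul, one_mul]; exact Nat.lt_div_mul_add (by positivity)
  have h1' : ((j / 2 ^ k : ℕ) : ℝ) * 2 ^ k ≤ j := by exact_mod_cast h1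
  have h2' : (j : ℝ) + 1 ≤ (((j / 2 ^ k : ℕ) : ℝ) + 1) * 2 ^ k := by exact_mod_cast h2
  apply Icc_subset_Icc
  · rw [div_le_div_iff₀ (by positivity) (by positivity), pow_add]
    nlinarith [pow_pos (two_pos (α := ℝ)) n₀]
  · rw [div_le_div_iff₀ (by positivity) (by positivity), pow_add]
    nlinarith [pow_pos (two_pos (α := ℝ)) n₀]

/-- Both `s` and `f * s` are contracting and agree near `∞`, so they involve the same number of
bisections and have the same image under `χ`. This is the description of `f` by a pair of dyadic
subdivisions with equally many pieces. -/
theorem map_eq_one_of_support {f : transAtTop} {b : ℕ} (h0 : ∀ t ≤ 0, (f : ℝ ≃o ℝ) t = t)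
    (hb : ∀ t, (b : ℝ) ≤ t → (f : ℝ ≃o ℝ) t = t) : χ f = 1 := by
  obtain ⟨n, hn⟩ := exists_standard_level f.2.1 b
  let s : transAtTop := ⟨shrink n b, shrink_mem n b⟩
  have hle : b ≤ 2 ^ n * b := Nat.le_mul_of_pos_left _ (by positivity)
  have h1 : ∀ᶠ t in atTop, (s : ℝ ≃o ℝ) t = t - ((2 ^ n * b - b : ℕ) : ℝ) := by
    filter_upwards [eventually_ge_atTop (2 ^ n * b : ℝ)] with t ht
    change shrink n b t = _
    rw [shrink_of_ge ht]
    push_cast [hle]; ring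
  have h2 : ∀ᶠ t in atTop, ((f * s : transAtTop) : ℝ ≃o ℝ) t
      = t - ((2 ^ n * b - b : ℕ) : ℝ) := by
    filter_upwards [h1, eventually_ge_atTop (2 ^ n * b : ℝ)] with t h1 ht
    rw [Subgroup.coe_mul, RelIso.mul_apply, hb, h1]
    change _ ≤ shrink n b t
    rw [shrink_of_ge ht]
    linarith
  have hs : Contracting (s : ℝ ≃o ℝ) := by
    have := contracting_mul_shrink (f := 1) (n := n) (b := b) (fun _ _ => rfl) (fun _ _ => rfl)
      fun j _ => ⟨_, DyadicAffine.id, fun _ _ => rfl, n, 0, by simp⟩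
    rwa [one_mul] at this
  have hfs : Contracting ((f * s : transAtTop) : ℝ ≃o ℝ) := contracting_mul_shrink h0 hb hn
  have e1 := hs.map_mul_pow χ _ s h1
  have e2 := hfs.map_mul_pow χ _ (f * s) h2
  rwa [map_mul, mul_assoc, e1, mul_one] at e2

end character

/-! ### The compactly supported group is perfect -/

theorem compactSupp_Ioi_le : compactSupp (Ioi 0) ≤ ⁅transAtTop, transAtTop⁆ := by
  rintro f ⟨hf, K, hK, hKS, h⟩
  obtain ⟨M, hM⟩ := hK.bddAbove
  obtain ⟨b, hb⟩ := exists_nat_gt M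
  have h0 : ∀ t ≤ 0, f t = t := fun t ht => h t fun hh => absurd (hKS hh) (not_lt.2 ht)
  have h1 : ∀ t, (b : ℝ) ≤ t → f t = t := fun t ht => h t fun hh => by
    have := hM hh
    linarith
  have hfT : f ∈ transAtTop := ⟨hf, by
    filter_upwards [eventually_le_atBot 0] with t ht using h0 t ht, 0, by
    filter_upwards [eventually_ge_atTop (b : ℝ)] with t ht
    rw [h1 t ht]; simp⟩
  have := map_eq_one_of_support Abelianization.of (f := ⟨f, hfT⟩) h0 h1
  have hc : (⟨f, hfT⟩ : transAtTop) ∈ commutator transAtTop := by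
    rw [← Abelianization.ker_of]; exact this
  have h2 := Subgroup.mem_map_of_mem transAtTop.subtype hc
  rwa [Subgroup.map_subtype_commutator] at h2

/-- The nodes are `-2 ^ (-j)`. The functional equation turns integral translations near `∞` into
homotheties of slope a power of `2` near `0`. -/
theorem exists_stairs_Iio : ∃ φ : ℝ → ℝ, StrictMono φ ∧ (∀ x, LocPLAt φ x) ∧
    range φ = Iio 0 ∧ φ 0 = -1 ∧ ∀ (l : ℤ) (t : ℝ), φ (t + l) = 2 ^ (-l) * φ t := by
  let a : ℤ → ℝ := fun j => -2 ^ (-j)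
  let k : ℤ → ℤ := fun j => -j - 1
  have ha : ∀ j, a (j + 1) = a j + 2 ^ k j := by
    intro j
    simp only [a, k, neg_add', zpow_sub₀ (two_ne_zero' ℝ), zpow_one]
    ring
  refine ⟨stairs a k, stairs_strictMono ha, stairs_locPLAt ha ?_,
    range_stairs ha ordConnected_Iio ?_ ?_ ?_, ?_, ?_⟩
  · exact (isDyadic_zpow _).neg
  · intro j
    simpa [a] using two_zpow_pos (-j)
  · intro y hy
    obtain ⟨n, hn⟩ := pow_unbounded_of_one_lt (-y) (one_lt_two (α := ℝ))
    refine ⟨-n, ?_⟩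
    simp only [a, neg_neg, zpow_natCast]
    linarith
  · intro y hy
    obtain ⟨n, hn⟩ := exists_pow_lt_of_lt_one (neg_pos.2 hy) (by norm_num : (1 / 2 : ℝ) < 1)
    refine ⟨n, ?_⟩
    simp only [a, zpow_neg, zpow_natCast]
    rw [one_div, inv_pow] at hn
    linarith
  · have := stairs_intCast ha 0
    simpa [a] using this
  · intro l t
    simp only [stairs, a, k, Int.floor_add_intCast]
    rw [show -(⌊t⌋ + l) - 1 = -l + (-⌊t⌋ - 1) by ring, show -(⌊t⌋ + l) = -l + -⌊t⌋ by ring,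
      zpow_add₀ two_ne_zero, zpow_add₀ two_ne_zero]
    push_cast; ring

/-- Conjugation by `φ` sends `transAtTop` into the compactly supported group: triviality near `-∞`
bounds the support, and translation by `l` near `∞` becomes slope `2 ^ (-l)` to the left of `0`, an
admissible break. As `φ` maps `(0, ∞)` onto `(-1, 0)`, `compactSupp_Ioi_le` is carried to the claim.
-/
theorem compactSupp_Ioo_le : compactSupp (Ioo (-1) 0) ≤
    ⁅compactSupp univ, compactSupp univ⁆ := by
  obtain ⟨φ, hφ, hPL, hr, hφ0, hshift⟩ := exists_stairs_Iio
  have hoc : (range φ).OrdConnected := hr ▸ ordConnected_Iio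
  have ho : IsOpen (range φ) := hr ▸ isOpen_Iio
  have hT : transAtTop.map (conjHom hφ hoc) ≤ compactSupp univ := by
    rintro _ ⟨f, ⟨hf, hbot, l, htop⟩, rfl⟩
    obtain ⟨M, hM⟩ := eventually_atBot.1 hbot
    obtain ⟨N, hN⟩ := eventually_atTop.1 htop
    have hpos : ∀ t, 0 ≤ t → conjHom hφ hoc f t = t := fun t ht =>
      conjHom_of_notMem hφ hoc f (by rw [hr]; exact not_lt.2 ht)
    have hneg : ∀ t ≤ φ M, conjHom hφ hoc f t = t := by
      intro t ht
      have hlt : φ M ∈ Iio 0 := hr ▸ mem_range_self M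
      obtain ⟨s, rfl⟩ : t ∈ range φ := by rw [hr]; exact ht.trans_lt hlt
      rw [conjHom_apply, hM s (hφ.le_iff_le.1 ht)]
    have hleft : ∀ᶠ t in 𝓝[≤] 0, conjHom hφ hoc f t = 2 ^ (-l) * t := by
      have hN0 : φ N < 0 := by
        have : φ N ∈ Iio 0 := hr ▸ mem_range_self N
        exact this
      filter_upwards [self_mem_nhdsWithin, nhdsWithin_le_nhds (Ioi_mem_nhds hN0)] with t h1 h2
      rcases (show t ≤ 0 from h1).eq_or_lt with rfl | h1
      · simpa using hpos 0 le_rfl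
      · obtain ⟨s, rfl⟩ : t ∈ range φ := by rw [hr]; exact h1
        rw [conjHom_apply, hN s (hφ.lt_iff_lt.1 h2).le, hshift]
    refine ⟨fun t => ?_, Icc (φ M) 0, isCompact_Icc, subset_univ _, fun t ht => ?_⟩
    · rcases lt_trichotomy t 0 with h | rfl | h
      · exact conjHom_locPLAt hφ hoc hPL ho hf (by rwa [hr])
      · refine ⟨⟨_, DyadicAffine.id, ?_⟩, ⟨_, DyadicAffine.mk (-l) isDyadic_zero, ?_⟩,
          fun h => absurd isDyadic_zero h⟩
        · filter_upwards [self_mem_nhdsWithin] with t ht using hpos t ht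
        · filter_upwards [hleft] with t ht
          rw [ht, add_zero]
      · refine (DyadicAffine.id.locPLAt t).congr ?_
        filter_upwards [Ioi_mem_nhds h] with t ht using hpos t (le_of_lt ht)
    · rcases le_total 0 t with h | h
      · exact hpos t h
      · rcases le_total t (φ M) with h' | h'
        · exact hneg t h'
        · exact absurd ⟨h', h⟩ ht
  intro g hg
  obtain ⟨f, hf, rfl⟩ := exists_conjHom_eq hφ hoc hPL
    (compactSupp_mono (hr ▸ Ioo_subset_Iio_self) hg)
  have hfs : f ∈ compactSupp (Ioi 0) := by
    obtain ⟨-, K, hK, hKS, h⟩ := hg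
    refine ⟨hf.1, Function.invFun φ '' K, ?_, ?_, fun t ht => ?_⟩
    · refine hK.image_of_continuousOn fun t ht => ContinuousAt.continuousWithinAt ?_
      obtain ⟨s, rfl⟩ : t ∈ range φ := by rw [hr]; exact (hKS ht).2
      exact ((hPL s).leftInverse (invFun_apply hφ)).continuousAt
    · rintro _ ⟨t, ht, rfl⟩
      obtain ⟨s, rfl⟩ : t ∈ range φ := by rw [hr]; exact (hKS ht).2
      rw [invFun_apply hφ, mem_Ioi, ← hφ.lt_iff_lt, hφ0]
      exact (hKS ht).1
    · apply hφ.injective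
      rw [← conjHom_apply hφ hoc, h]
      exact fun hh => ht ⟨_, hh, invFun_apply hφ t⟩
  have h1 := Subgroup.mem_map_of_mem (conjHom hφ hoc) (compactSupp_Ioi_le hfs)
  rw [Subgroup.map_commutator] at h1
  exact Subgroup.commutator_mono hT hT h1

theorem conj_mem_compactSupp {S S' : Set ℝ} {s f : ℝ ≃o ℝ} (hs : s ∈ locPL)
    (hS : MapsTo s S S') (hf : f ∈ compactSupp S) : s * f * s⁻¹ ∈ compactSupp S' := by
  obtain ⟨hf, K, hK, hKS, h⟩ := hf
  refine ⟨mul_mem (mul_mem hs hf) (inv_mem hs), s '' K, hK.image s.continuous,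
    (hS.mono_left hKS).image_subset, fun t ht => ?_⟩
  rw [RelIso.mul_apply, RelIso.mul_apply, h, apply_inv_self']
  exact fun hh => ht ⟨_, hh, apply_inv_self' s t⟩

/-- An affine dyadic contraction moves any compact support into `(-1, 0)`, and conjugation by it
preserves the compactly supported group. -/
theorem commutator_compactSupp_univ : ⁅compactSupp univ, compactSupp univ⁆ = compactSupp univ := by
  refine le_antisymm (Subgroup.commutator_le_self _) fun f hf => ?_
  obtain ⟨-, K, hK, -, h⟩ := id hf
  obtain ⟨M, hM⟩ := hK.isBounded.exists_norm_le
  obtain ⟨q, hq⟩ := pow_unbounded_of_one_lt (2 * |M|) (one_lt_two (α := ℝ))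
  let s := affIso (-(q : ℤ)) (-(1 / 2))
  have hs : s ∈ locPL := affIso_mem _ (IsDyadic.neg ⟨1, 1, by norm_num⟩)
  have hfK : f ∈ compactSupp K := ⟨hf.1, K, hK, subset_rfl, h⟩
  have hmaps : MapsTo s K (Ioo (-1) 0) := by
    intro t ht
    have h1 : |t| ≤ |M| := (hM t ht).trans (le_abs_self M)
    have h2 : |((2 : ℝ) ^ q)⁻¹ * t| < 1 / 2 := by
      rw [abs_mul, abs_of_pos (by positivity), inv_mul_lt_iff₀ (by positivity)]
      linarith
    rw [abs_lt] at h2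
    simp only [s, affIso_apply, zpow_neg, zpow_natCast, mem_Ioo]
    constructor <;> linarith
  have h1 := compactSupp_Ioo_le (conj_mem_compactSupp hs hmaps hfK)
  have h2 := Subgroup.mem_map_of_mem (MulAut.conj s⁻¹).toMonoidHom h1
  rw [Subgroup.map_commutator] at h2
  have hle : (compactSupp univ).map (MulAut.conj s⁻¹).toMonoidHom ≤ compactSupp univ := by
    rintro _ ⟨g, hg, rfl⟩
    exact conj_mem_compactSupp (inv_mem hs) (mapsTo_univ _ _) hg
  have h3 := Subgroup.commutator_mono hle hle h2
  have e : (MulAut.conj s⁻¹).toMonoidHom (s * f * s⁻¹) = f := by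
    simp [mul_assoc]
  rwa [e] at h3

/-! ### Thompson's group as a group of order automorphisms of the line -/

open Classical in
/-- Extension of a self-map of `[0, 1]` by the identity. -/
noncomputable def extFun (f : I → I) (t : ℝ) : ℝ := if h : t ∈ I then f ⟨t, h⟩ else t

theorem extFun_coe (f : I → I) (x : I) : extFun f x = f x := by
  rw [extFun, dif_pos x.2]

theorem extFun_of_notMem (f : I → I) {t : ℝ} (h : t ∉ I) : extFun f t = t := by
  rw [extFun, dif_neg h]

theorem extFun_comp (f g : I → I) (t : ℝ) :
    extFun (fun x => f (g x)) t = extFun f (extFun g t) := by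
  by_cases h : t ∈ I
  · lift t to I using h
    simp only [extFun_coe]
  · simp only [extFun_of_notMem _ h]

theorem extFun_id (t : ℝ) : extFun (fun x => x) t = t := by
  by_cases h : t ∈ I
  · lift t to I using h
    rw [extFun_coe]
  · exact extFun_of_notMem _ h

theorem extFun_strictMono {f : I → I} (hf : StrictMono f) : StrictMono (extFun f) := by
  intro x y hxy
  by_cases hx : x ∈ I <;> by_cases hy : y ∈ I
  · lift x to I using hx
    lift y to I using hy
    rw [extFun_coe, extFun_coe]
    exact hf hxy
  · lift x to I using hx
    rw [extFun_coe, extFun_of_notMem _ hy]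
    have h1 : ¬ y ≤ 1 := fun h => hy ⟨x.2.1.trans hxy.le, h⟩
    exact (f x).2.2.trans_lt (not_le.1 h1)
  · lift y to I using hy
    rw [extFun_coe, extFun_of_notMem _ hx]
    have h1 : ¬ 0 ≤ x := fun h => hx ⟨h, hxy.le.trans y.2.2⟩
    exact (not_le.1 h1).trans_le (f y).2.1
  · rwa [extFun_of_notMem _ hx, extFun_of_notMem _ hy]

/-- Elements of Thompson's group, extended by the identity. -/
noncomputable def extHom : thompsonF →* (ℝ ≃o ℝ) where
  toFun f := StrictMono.orderIsoOfRightInverse (extFun (f : I ≃ₜ I)) (extFun_strictMono f.2.1)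
    (extFun (f : I ≃ₜ I).symm) (fun t => by
      rw [← extFun_comp]
      simp only [Homeomorph.apply_symm_apply, extFun_id])
  map_one' := by
    ext t
    exact extFun_id t
  map_mul' f g := by
    ext t
    exact extFun_comp (f : I ≃ₜ I) (g : I ≃ₜ I) t

theorem extHom_apply (f : thompsonF) (x : I) : extHom f x = (f : I ≃ₜ I) x := extFun_coe _ x

theorem extHom_of_notMem (f : thompsonF) {t : ℝ} (h : t ∉ I) : extHom f t = t :=
  extFun_of_notMem _ h

theorem extHom_injective : Function.Injective extHom := by
  intro f g h
  ext x
  rw [← extHom_apply, h, extHom_apply]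

theorem extHom_zero (f : thompsonF) : extHom f 0 = 0 := by
  have := extHom_apply f 0
  rwa [strictMono_map_zero f.2.1] at this

theorem extHom_one (f : thompsonF) : extHom f 1 = 1 := by
  have h := extHom_apply f 1
  have : (f : I ≃ₜ I) 1 = 1 := by
    apply le_antisymm unitInterval.le_one'
    have h := f.2.1.monotone (unitInterval.le_one' (t := (f : I ≃ₜ I).symm 1))
    rwa [Homeomorph.apply_symm_apply] at h
  rwa [this] at h

theorem extHom_of_notMem_Ioo (f : thompsonF) {t : ℝ} (h : t ∉ Ioo 0 1) : extHom f t = t := by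
  by_cases ht : t ∈ I
  · rcases ht.1.eq_or_lt with h0 | h0
    · rw [← h0]; exact extHom_zero f
    · rcases ht.2.eq_or_lt with h1 | h1
      · rw [h1]; exact extHom_one f
      · exact absurd ⟨h0, h1⟩ h
  · exact extHom_of_notMem f ht

theorem eventually_nhdsGT_no_break (B : Finset I) (x : ℝ) :
    ∀ᶠ y : ℝ in 𝓝[>] x, ∀ b ∈ B, ¬ (x < b ∧ b < y) := by
  rw [eventually_all_finset]
  intro b _
  by_cases h : x < b
  · filter_upwards [nhdsWithin_le_nhds (Iio_mem_nhds h)] with y hy h'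
    exact absurd h'.2 (not_lt.2 (le_of_lt hy))
  · exact Eventually.of_forall fun y h' => h h'.1

theorem eventually_nhdsLT_no_break (B : Finset I) (x : ℝ) :
    ∀ᶠ y : ℝ in 𝓝[<] x, ∀ b ∈ B, ¬ (y < b ∧ b < x) := by
  rw [eventually_all_finset]
  intro b _
  by_cases h : b < x
  · filter_upwards [nhdsWithin_le_nhds (Ioi_mem_nhds h)] with y hy h'
    exact absurd h'.1 (not_lt.2 (le_of_lt hy))
  · exact Eventually.of_forall fun y h' => h h'.2

theorem extHom_mem_locPL (f : thompsonF) : extHom f ∈ locPL := by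
  obtain ⟨B, hB, hpl⟩ := f.2.2
  have key : ∀ x y : ℝ, 0 ≤ x → x < y → y ≤ 1 → (∀ b ∈ B, ¬ (x < b ∧ b < y)) →
      AffineAlong (𝓟 (Icc x y)) (extHom f) := by
    intro x y hx hxy hy hb
    -- The definition of `F` controls slopes only. A dyadic point `d` in the piece shows that the
    -- constant term `f d - 2 ^ k * d` is dyadic, which may not be read off at `x`.
    obtain ⟨d, hd, hxd, hdy⟩ := exists_dyadic_btwn hxy
    lift x to I using ⟨hx, hxy.le.trans hy⟩
    lift y to I using ⟨hx.trans hxy.le, hy⟩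
    lift d to I using ⟨hx.trans hxd.le, hdy.le.trans hy⟩
    obtain ⟨k, hk⟩ := hpl x y hxy.le hb
    refine ⟨_, DyadicAffine.mk k (isDyadic_sub
      ((f.2.2.isDyadic_iff f.2.1 d).2 hd) (hd.zpow_mul k)), ?_⟩
    intro t ht
    lift t to I using ⟨hx.trans ht.1, ht.2.trans hy⟩
    change extHom f t = 2 ^ k * (t : ℝ) + _
    rw [extHom_apply, hk t ht.1 ht.2, hk d hxd.le hdy.le]
    ring
  intro x
  by_cases hx : x ∈ Icc (0 : ℝ) 1
  · have hright : x < 1 → ∃ y, x < y ∧ y ≤ 1 ∧ ∀ b ∈ B, ¬ (x < b ∧ b < y) := fun h1 => by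
      obtain ⟨y, ⟨h2, h3⟩, h4⟩ := ((eventually_nhdsGT_no_break B x).and
        (nhdsWithin_le_nhds (Iio_mem_nhds h1)) |>.and self_mem_nhdsWithin).exists
      exact ⟨y, h4, le_of_lt h3, h2⟩
    have hleft : 0 < x → ∃ y, y < x ∧ 0 ≤ y ∧ ∀ b ∈ B, ¬ (y < b ∧ b < x) := fun h1 => by
      obtain ⟨y, ⟨h2, h3⟩, h4⟩ := ((eventually_nhdsLT_no_break B x).and
        (nhdsWithin_le_nhds (Ioi_mem_nhds h1)) |>.and self_mem_nhdsWithin).exists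
      exact ⟨y, h4, le_of_lt h3, h2⟩
    refine ⟨?_, ?_, fun hxd => ?_⟩
    · rcases hx.2.eq_or_lt with rfl | h1
      · refine ⟨_, DyadicAffine.id, ?_⟩
        filter_upwards [self_mem_nhdsWithin] with t ht
        exact extHom_of_notMem_Ioo f fun h => absurd h.2 (not_lt.2 ht)
      · obtain ⟨y, hxy, hy, hb⟩ := hright h1
        exact (key x y hx.1 hxy hy hb).mono (le_principal_iff.2 (Icc_mem_nhdsGE hxy))
    · rcases hx.1.eq_or_lt with rfl | h1
      · refine ⟨_, DyadicAffine.id, ?_⟩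
        filter_upwards [self_mem_nhdsWithin] with t ht
        exact extHom_of_notMem_Ioo f fun h => absurd h.1 (not_lt.2 ht)
      · obtain ⟨y, hyx, hy, hb⟩ := hleft h1
        exact (key y x hy hyx hx.2 hb).mono (le_principal_iff.2 (Icc_mem_nhdsLE hyx))
    · have h0 : 0 < x := hx.1.lt_of_ne fun h => hxd (h ▸ isDyadic_zero)
      have h1 : x < 1 := hx.2.lt_of_ne fun h => hxd (h ▸ isDyadic_one)
      obtain ⟨y, hxy, hy, hb⟩ := hright h1
      obtain ⟨z, hzx, hz, hb'⟩ := hleft h0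
      refine (key z y hz (hzx.trans hxy) hy fun b hb'' h => ?_).mono
        (le_principal_iff.2 (Icc_mem_nhds hzx hxy))
      rcases lt_trichotomy (b : ℝ) x with h' | h' | h'
      · exact hb' b hb'' ⟨h.1, h'⟩
      · exact hxd (h' ▸ hB b hb'')
      · exact hb b hb'' ⟨h', h.2⟩
  · refine (DyadicAffine.id.locPLAt x).congr ?_
    filter_upwards [isClosed_Icc.isOpen_compl.mem_nhds hx] with t ht using extHom_of_notMem f ht

/-- The elements of `locPL` supported in `(0, 1)` that fix all points of `U`. -/
def unitFixing (U : Set ℝ) : Subgroup (ℝ ≃o ℝ) where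
  carrier := {f | f ∈ locPL ∧ (∀ t ∉ Ioo 0 1, f t = t) ∧ ∀ u ∈ U, f u = u}
  one_mem' := ⟨one_mem _, fun _ _ => rfl, fun _ _ => rfl⟩
  mul_mem' := fun {f g} ⟨hf, hf', hf''⟩ ⟨hg, hg', hg''⟩ => ⟨mul_mem hf hg, fun t ht => by
    rw [RelIso.mul_apply, hg' t ht, hf' t ht], fun t ht => by
    rw [RelIso.mul_apply, hg'' t ht, hf'' t ht]⟩
  inv_mem' := fun {f} ⟨hf, hf', hf''⟩ => ⟨inv_mem hf, fun t ht => inv_apply_eq_iff.2 (hf' t ht),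
    fun t ht => inv_apply_eq_iff.2 (hf'' t ht)⟩

theorem exists_extHom_eq {g : ℝ ≃o ℝ} (hg : g ∈ locPL) (h : ∀ t ∉ Ioo 0 1, g t = t) :
    ∃ f : thompsonF, extHom f = g := by
  have hI : ∀ g : ℝ ≃o ℝ, (∀ t ∉ Ioo (0 : ℝ) 1, g t = t) → ∀ x : I, g x ∈ I := by
    intro g h x
    have h0 := g.monotone x.2.1
    have h1 := g.monotone x.2.2
    rw [h 0 (by simp)] at h0
    rw [h 1 (by simp)] at h1
    exact ⟨h0, h1⟩
  have h' : ∀ t ∉ Ioo (0 : ℝ) 1, g⁻¹ t = t := fun t ht => inv_apply_eq_iff.2 (h t ht)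
  let f : I ≃ₜ I :=
    { toFun := fun x => ⟨g x, hI g h x⟩
      invFun := fun x => ⟨g⁻¹ x, hI g⁻¹ h' x⟩
      left_inv := fun x => by simp
      right_inv := fun x => by simp
      continuous_toFun := (g.continuous.comp continuous_subtype_val).subtype_mk _
      continuous_invFun := ((g⁻¹).continuous.comp continuous_subtype_val).subtype_mk _ }
  have hf : ∀ x : I, ((f x : I) : ℝ) = g x := fun _ => rfl
  have hmono : StrictMono f := fun x y hxy => g.strictMono (show (x : ℝ) < y from hxy)
  have hpl : IsDyadicPL f := by
    classical
    obtain ⟨B, hB, hBpl⟩ := exists_breaks hg 0 1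
    refine ⟨B.subtype (· ∈ I), fun b hb => hB b (Finset.mem_subtype.1 hb),
      fun x y hxy hno => ?_⟩
    obtain ⟨A, ⟨k, d, hd, hA⟩, hgA⟩ := hBpl x y x.2.1 hxy y.2.2 fun c hc hc' =>
      hno ⟨c, x.2.1.trans hc'.1.le, hc'.2.le.trans y.2.2⟩ (Finset.mem_subtype.2 hc) hc'
    refine ⟨k, fun t h1 h2 => ?_⟩
    have hxx : (x : ℝ) ∈ Icc (x : ℝ) y := ⟨le_rfl, hxy⟩
    have htt : (t : ℝ) ∈ Icc (x : ℝ) y := ⟨h1, h2⟩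
    rw [hf, hf, hgA hxx, hgA htt, hA, hA]
    ring
  refine ⟨⟨f, hmono, hpl⟩, ?_⟩
  ext t
  by_cases ht : t ∈ I
  · lift t to I using ht
    rw [extHom_apply]
    exact hf t
  · rw [extHom_of_notMem _ ht, h]
    exact fun hh => ht (Ioo_subset_Icc_self hh)

theorem map_pointStabilizer {U : Set ℝ} (hU : U ⊆ Ioo 0 1) :
    (pointStabilizer U).map extHom = unitFixing U := by
  apply le_antisymm
  · rintro _ ⟨f, hf, rfl⟩
    refine ⟨extHom_mem_locPL f, fun t ht => extHom_of_notMem_Ioo f ht, fun u hu => ?_⟩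
    have huI : u ∈ I := Ioo_subset_Icc_self (hU hu)
    lift u to I using huI
    rw [extHom_apply, hf u hu]
  · rintro g ⟨hg, h0, hg'⟩
    obtain ⟨f, rfl⟩ := exists_extHom_eq hg h0
    refine ⟨f, fun x hx => ?_, rfl⟩
    have := hg' x hx
    rw [extHom_apply] at this
    exact Subtype.ext this

theorem range_extHom : extHom.range = unitFixing ∅ := by
  apply le_antisymm
  · rintro _ ⟨f, rfl⟩
    exact ⟨extHom_mem_locPL f, fun t ht => extHom_of_notMem_Ioo f ht, fun u hu => hu.elim⟩
  · rintro g ⟨hg, h0, -⟩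
    exact exists_extHom_eq hg h0

/-! ### Germs -/

/-- The filter of right (`true`) or left (`false`) neighbourhoods of a point. -/
def sideNhds (x : ℝ) : Bool → Filter ℝ
  | true => 𝓝[≥] x
  | false => 𝓝[≤] x

theorem sideNhds_le (x : ℝ) (b : Bool) : sideNhds x b ≤ 𝓝 x := by
  cases b <;> exact nhdsWithin_le_nhds

theorem exists_ne_of_eventually_sideNhds {x : ℝ} {b : Bool} {p : ℝ → Prop}
    (h : ∀ᶠ t in sideNhds x b, p t) : ∃ t, t ≠ x ∧ p t := by
  cases b
  · have h1 : ∀ᶠ t in 𝓝[<] x, p t := h.filter_mono (nhdsWithin_mono _ Iio_subset_Iic_self)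
    obtain ⟨t, h1, h2⟩ := (h1.and self_mem_nhdsWithin).exists
    exact ⟨t, ne_of_lt h2, h1⟩
  · have h1 : ∀ᶠ t in 𝓝[>] x, p t := h.filter_mono (nhdsWithin_mono _ Ioi_subset_Ici_self)
    obtain ⟨t, h1, h2⟩ := (h1.and self_mem_nhdsWithin).exists
    exact ⟨t, ne_of_gt h2, h1⟩

/-- The elements of `locPL` that fix `x`. -/
def fixing (x : ℝ) : Subgroup (ℝ ≃o ℝ) where
  carrier := {f | f ∈ locPL ∧ f x = x}
  one_mem' := ⟨one_mem _, rfl⟩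
  mul_mem' := fun {f g} ⟨hf, hf'⟩ ⟨hg, hg'⟩ => ⟨mul_mem hf hg, by
    rw [RelIso.mul_apply, hg', hf']⟩
  inv_mem' := fun {f} ⟨hf, hf'⟩ => ⟨inv_mem hf, inv_apply_eq_iff.2 hf'⟩

theorem tendsto_sideNhds {x : ℝ} {f : ℝ ≃o ℝ} (hf : f ∈ fixing x) (b : Bool) :
    Tendsto f (sideNhds x b) (sideNhds x b) := by
  cases b
  · have := (hf.1 x).tendsto_nhdsLE
    rwa [hf.2] at this
  · have := (hf.1 x).tendsto_nhdsGE
    rwa [hf.2] at this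

theorem DyadicAffine.exists_eq_of_fix {A : ℝ → ℝ} (hA : DyadicAffine A) {x : ℝ} (h : A x = x) :
    ∃ k : ℤ, ∀ t, A t = 2 ^ k * (t - x) + x := by
  obtain ⟨k, d, hd, hA⟩ := hA
  rw [hA] at h
  exact ⟨k, fun t => by rw [hA]; linear_combination h⟩

theorem exists_germ {x : ℝ} {f : ℝ ≃o ℝ} (hf : f ∈ fixing x) (b : Bool) :
    ∃ k : ℤ, ∀ᶠ t in sideNhds x b, f t = 2 ^ k * (t - x) + x := by
  obtain ⟨A, hA, h, hx⟩ : ∃ A, DyadicAffine A ∧ f =ᶠ[sideNhds x b] A ∧ A x = x := by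
    cases b
    · obtain ⟨A, hA, h⟩ := (hf.1 x).left
      exact ⟨A, hA, h, (h.eq_of_nhdsWithin self_mem_Iic).symm.trans hf.2⟩
    · obtain ⟨A, hA, h⟩ := (hf.1 x).right
      exact ⟨A, hA, h, (h.eq_of_nhdsWithin self_mem_Ici).symm.trans hf.2⟩
  obtain ⟨k, hk⟩ := hA.exists_eq_of_fix hx
  refine ⟨k, ?_⟩
  filter_upwards [h] with t ht
  rw [ht, hk]

theorem germ_unique {x : ℝ} {b : Bool} {f : ℝ → ℝ} {k l : ℤ}
    (hk : ∀ᶠ t in sideNhds x b, f t = 2 ^ k * (t - x) + x)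
    (hl : ∀ᶠ t in sideNhds x b, f t = 2 ^ l * (t - x) + x) : k = l := by
  obtain ⟨t, htx, h1, h2⟩ := exists_ne_of_eventually_sideNhds (hk.and hl)
  rw [h1, add_left_inj] at h2
  exact zpow_right_injective₀ (by norm_num) (by norm_num)
    (mul_right_cancel₀ (sub_ne_zero.2 htx) h2)

/-- The exponent of the one-sided slope at a fixed point. -/
noncomputable def germ (x : ℝ) (b : Bool) : fixing x →* Multiplicative ℤ :=
  MonoidHom.mk' (fun f => Multiplicative.ofAdd (exists_germ f.2 b).choose) (by
    intro f g
    rw [← ofAdd_add]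
    congr 1
    refine germ_unique (exists_germ (f * g).2 b).choose_spec ?_
    filter_upwards [(exists_germ g.2 b).choose_spec,
      (tendsto_sideNhds g.2 b).eventually (exists_germ f.2 b).choose_spec] with t h1 h2
    rw [Subgroup.coe_mul, RelIso.mul_apply, h2, h1, zpow_add₀ two_ne_zero]
    ring)

theorem germ_spec {x : ℝ} (b : Bool) (f : fixing x) : ∀ᶠ t in sideNhds x b,
    (f : ℝ ≃o ℝ) t = 2 ^ (germ x b f).toAdd * (t - x) + x :=
  (exists_germ f.2 b).choose_spec

theorem germ_eq {x : ℝ} {b : Bool} {f : fixing x} {k : ℤ}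
    (h : ∀ᶠ t in sideNhds x b, (f : ℝ ≃o ℝ) t = 2 ^ k * (t - x) + x) :
    (germ x b f).toAdd = k := germ_unique (germ_spec b f) h

theorem germ_eq_one_iff {x : ℝ} {b : Bool} {f : fixing x} :
    germ x b f = 1 ↔ ∀ᶠ t in sideNhds x b, (f : ℝ ≃o ℝ) t = t := by
  constructor
  · intro h
    filter_upwards [germ_spec b f] with t ht
    rw [ht, h]; simp
  · intro h
    apply Multiplicative.toAdd.injective
    refine germ_eq ?_
    filter_upwards [h] with t ht
    rw [ht]; simp

theorem germ_true_eq_false {x : ℝ} (hx : ¬ IsDyadic x) (f : fixing x) :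
    germ x true f = germ x false f := by
  obtain ⟨A, hA, h⟩ := (f.2.1 x).both hx
  obtain ⟨k, hk⟩ := hA.exists_eq_of_fix (h.eq_of_nhds.symm.trans f.2.2)
  have : ∀ b, (germ x b f).toAdd = k := fun b => germ_eq (by
    filter_upwards [h.filter_mono (sideNhds_le x b)] with t ht
    rw [ht, hk])
  exact Multiplicative.toAdd.injective ((this true).trans (this false).symm)

theorem eventually_of_germ_eq_one {x : ℝ} {f : fixing x} (h : ∀ b, germ x b f = 1) :
    ∀ᶠ t in 𝓝 x, (f : ℝ ≃o ℝ) t = t := by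
  rw [← nhdsLE_sup_nhdsGE, eventually_sup]
  exact ⟨germ_eq_one_iff.1 (h false), germ_eq_one_iff.1 (h true)⟩

/-- The closure of the set of moved points is compact, and it misses every point near which `f` is
trivial. -/
theorem mem_compactSupp_of_germs {S : Set ℝ} {f : ℝ ≃o ℝ} (hf : f ∈ locPL)
    (h : ∀ t ∉ Ioo 0 1, f t = t) (h' : ∀ p ∈ Icc (0 : ℝ) 1, p ∉ S → ∀ᶠ t in 𝓝 p, f t = t) :
    f ∈ compactSupp S := by
  have hsub : closure {t | f t ≠ t} ⊆ Icc 0 1 := closure_minimal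
    (fun t ht => by
      by_contra hn
      exact ht (h t fun hh => hn (Ioo_subset_Icc_self hh))) isClosed_Icc
  refine ⟨hf, closure {t | f t ≠ t}, isCompact_Icc.of_isClosed_subset isClosed_closure hsub,
    fun p hp => ?_, fun t ht => ?_⟩
  · by_contra hpS
    obtain ⟨t, h1, h2⟩ := mem_closure_iff_nhds.1 hp _ (h' p (hsub hp) hpS)
    exact h2 h1
  · by_contra hn
    exact ht (subset_closure hn)

/-! ### The commutator subgroup of Thompson's group -/

open scoped commutatorElement

theorem commutator_eq_top_of_equiv {G G' : Type*} [Group G] [Group G'] (e : G ≃* G')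
    (h : commutator G = ⊤) : commutator G' = ⊤ := by
  have := congrArg (Subgroup.map e.toMonoidHom) h
  rwa [commutator_def, Subgroup.map_commutator,
    Subgroup.map_top_of_surjective e.toMonoidHom e.surjective, ← commutator_def] at this

theorem commutator_coe_eq_top_iff {G : Type*} [Group G] {H : Subgroup G} :
    commutator H = ⊤ ↔ ⁅H, H⁆ = H := by
  rw [← Subgroup.map_subtype_commutator]
  constructor
  · intro h
    rw [h, ← MonoidHom.range_eq_map, Subgroup.range_subtype]
  · intro h
    apply Subgroup.map_injective H.subtype_injective
    rw [h, ← MonoidHom.range_eq_map, Subgroup.range_subtype]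

theorem commutator_compactSupp_Ioo {a b : ℝ} (h : a < b) :
    ⁅compactSupp (Ioo a b), compactSupp (Ioo a b)⁆ = compactSupp (Ioo a b) := by
  obtain ⟨e⟩ := nonempty_compactSupp_equiv_Ioo h
  exact commutator_coe_eq_top_iff.1 (commutator_eq_top_of_equiv e
    (commutator_coe_eq_top_iff.2 commutator_compactSupp_univ))

theorem germ_commutatorElement (x : ℝ) (b : Bool) (f g : fixing x) : germ x b ⁅f, g⁆ = 1 := by
  rw [map_commutatorElement, commutatorElement_eq_one_iff_mul_comm, mul_comm]

theorem unitFixing_le_fixing {U : Set ℝ} {x : ℝ} (h : x ∈ U ∨ x ∉ Ioo 0 1) :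
    unitFixing U ≤ fixing x := by
  rintro f ⟨h1, h2, h3⟩
  exact ⟨h1, h.elim (h3 x) (h2 x)⟩

/-- Slopes at `0` and `1` are characters, so commutators are trivial near both ends; conversely the
compactly supported group is perfect. -/
theorem commutator_unitFixing_empty :
    ⁅unitFixing ∅, unitFixing ∅⁆ = compactSupp (Ioo 0 1) := by
  apply le_antisymm
  · rw [Subgroup.commutator_le]
    intro f hf g hg
    have hfg : ⁅f, g⁆ ∈ unitFixing ∅ :=
      Subgroup.commutator_le_self _ (Subgroup.commutator_mem_commutator hf hg)
    refine mem_compactSupp_of_germs hfg.1 hfg.2.1 fun p _ hp => ?_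
    have hle := unitFixing_le_fixing (U := ∅) (Or.inr hp)
    exact eventually_of_germ_eq_one fun b => germ_commutatorElement p b ⟨f, hle hf⟩ ⟨g, hle hg⟩
  · rw [← commutator_compactSupp_Ioo one_pos]
    have : compactSupp (Ioo 0 1) ≤ unitFixing ∅ := fun f hf =>
      ⟨hf.1, fun t ht => apply_eq_of_mem_compactSupp hf ht, fun u hu => hu.elim⟩
    exact Subgroup.commutator_mono this this

theorem map_commutator_thompsonF :
    (commutator thompsonF).map extHom = compactSupp (Ioo 0 1) := by
  rw [commutator_def, Subgroup.map_commutator, ← MonoidHom.range_eq_map, range_extHom,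
    commutator_unitFixing_empty]

theorem nonempty_commutator_equiv {a b : ℝ} (h : a < b) :
    Nonempty (commutator thompsonF ≃* compactSupp (Ioo a b)) := by
  obtain ⟨e⟩ := nonempty_compactSupp_equiv_Ioo h
  obtain ⟨e'⟩ := nonempty_compactSupp_equiv_Ioo (zero_lt_one' ℝ)
  exact ⟨((Subgroup.equivMapOfInjective _ _ extHom_injective).trans
    (MulEquiv.subgroupCongr map_commutator_thompsonF)).trans (e'.symm.trans e)⟩

theorem commutator_commutator_thompsonF : commutator (commutator thompsonF) = ⊤ := by
  obtain ⟨e⟩ := nonempty_commutator_equiv (zero_lt_one' ℝ)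
  exact commutator_eq_top_of_equiv e.symm
    (commutator_coe_eq_top_iff.2 (commutator_compactSupp_Ioo one_pos))

/-! ### Decomposition of compactly supported maps along gaps -/

open Classical in
/-- The restriction of `f` to `(a, b)`, extended by the identity. -/
noncomputable def restrFun (a b : ℝ) (f : ℝ → ℝ) (t : ℝ) : ℝ := if t ∈ Ioo a b then f t else t

theorem restrFun_of_mem {a b t : ℝ} (f : ℝ → ℝ) (h : t ∈ Ioo a b) : restrFun a b f t = f t :=
  if_pos h

theorem restrFun_of_notMem {a b t : ℝ} (f : ℝ → ℝ) (h : t ∉ Ioo a b) : restrFun a b f t = t :=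
  if_neg h

section restr

variable {a b : ℝ} {S : Set ℝ} (ha : a ∉ S) (hb : b ∉ S)

include ha hb in
theorem apply_mem_Ioo {f : ℝ ≃o ℝ} (hf : f ∈ compactSupp S) {t : ℝ} (ht : t ∈ Ioo a b) :
    f t ∈ Ioo a b := by
  have h1 := f.strictMono ht.1
  have h2 := f.strictMono ht.2
  rw [apply_eq_of_mem_compactSupp hf ha] at h1
  rw [apply_eq_of_mem_compactSupp hf hb] at h2
  exact ⟨h1, h2⟩

include ha hb in
theorem restrFun_comp (f : ℝ → ℝ) {g : ℝ ≃o ℝ} (hg : g ∈ compactSupp S) (t : ℝ) :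
    restrFun a b (fun t => f (g t)) t = restrFun a b f (restrFun a b g t) := by
  by_cases h : t ∈ Ioo a b
  · rw [restrFun_of_mem _ h, restrFun_of_mem _ h,
      restrFun_of_mem _ (apply_mem_Ioo ha hb hg h)]
  · simp only [restrFun_of_notMem _ h]

include ha hb in
theorem restrFun_strictMono {f : ℝ ≃o ℝ} (hf : f ∈ compactSupp S) :
    StrictMono (restrFun a b f) := by
  intro x y hxy
  by_cases hx : x ∈ Ioo a b <;> by_cases hy : y ∈ Ioo a b
  · rw [restrFun_of_mem _ hx, restrFun_of_mem _ hy]; exact f.strictMono hxy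
  · rw [restrFun_of_mem _ hx, restrFun_of_notMem _ hy]
    have h : b ≤ y := by
      by_contra h
      exact hy ⟨hx.1.trans hxy, not_le.1 h⟩
    exact (apply_mem_Ioo ha hb hf hx).2.trans_le h
  · rw [restrFun_of_notMem _ hx, restrFun_of_mem _ hy]
    have h : x ≤ a := by
      by_contra h
      exact hx ⟨not_le.1 h, hxy.trans hy.2⟩
    exact h.trans_lt (apply_mem_Ioo ha hb hf hy).1
  · rwa [restrFun_of_notMem _ hx, restrFun_of_notMem _ hy]

theorem restrFun_id (t : ℝ) : restrFun a b (fun t => t) t = t := by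
  rw [restrFun, ite_self]

/-- Restriction to `(a, b)` as a homomorphism. -/
noncomputable def restrHom : compactSupp S →* (ℝ ≃o ℝ) where
  toFun f := StrictMono.orderIsoOfRightInverse (restrFun a b (f : ℝ ≃o ℝ))
    (restrFun_strictMono ha hb f.2) (restrFun a b (f⁻¹ : compactSupp S)) (fun t => by
      refine (restrFun_comp ha hb (f : ℝ ≃o ℝ) (f⁻¹).2 t).symm.trans ?_
      simp only [Subgroup.coe_inv, apply_inv_self', restrFun_id])
  map_one' := by
    ext t
    exact restrFun_id t
  map_mul' f g := by
    ext t
    exact restrFun_comp ha hb (f : ℝ ≃o ℝ) g.2 t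

theorem restrHom_of_mem (f : compactSupp S) {t : ℝ} (ht : t ∈ Ioo a b) :
    restrHom ha hb f t = (f : ℝ ≃o ℝ) t := restrFun_of_mem _ ht

theorem restrHom_of_notMem (f : compactSupp S) {t : ℝ} (ht : t ∉ Ioo a b) :
    restrHom ha hb f t = t := restrFun_of_notMem _ ht

theorem restrHom_mem (f : compactSupp S) : restrHom ha hb f ∈ compactSupp (Ioo a b) := by
  obtain ⟨hf, K, hK, hKS, h⟩ := f.2
  have hKI : K ∩ Icc a b ⊆ Ioo a b := fun t ht =>
    ⟨ht.2.1.lt_of_ne fun e => ha (e ▸ hKS ht.1), ht.2.2.lt_of_ne fun e => hb (e ▸ hKS ht.1)⟩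
  have hi : ∀ t ∉ K ∩ Icc a b, restrHom ha hb f t = t := by
    intro t ht
    by_cases hI : t ∈ Ioo a b
    · rw [restrHom_of_mem ha hb f hI, h]
      exact fun hk => ht ⟨hk, Ioo_subset_Icc_self hI⟩
    · exact restrHom_of_notMem ha hb f hI
  have hc : IsCompact (K ∩ Icc a b) := hK.inter_right isClosed_Icc
  refine ⟨fun x => ?_, _, hc, hKI, hi⟩
  by_cases hx : x ∈ Ioo a b
  · refine (hf x).congr ?_
    filter_upwards [isOpen_Ioo.mem_nhds hx] with t ht using restrHom_of_mem ha hb f ht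
  · refine (DyadicAffine.id.locPLAt x).congr ?_
    filter_upwards [hc.isClosed.isOpen_compl.mem_nhds fun h => hx (hKI h)] with t ht using hi t ht

end restr

/-- The `i`-th gap between consecutive values of `p`. -/
def gap {n : ℕ} (p : Fin (n + 1) → ℝ) (i : Fin n) : Set ℝ := Ioo (p i.castSucc) (p i.succ)

theorem gap_unique {n : ℕ} {p : Fin (n + 1) → ℝ} (hp : StrictMono p) {i j : Fin n} {t : ℝ}
    (hi : t ∈ gap p i) (hj : t ∈ gap p j) : i = j := by
  have key : ∀ i j : Fin n, t ∈ gap p i → t ∈ gap p j → ¬ i < j := by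
    intro i j hi hj h
    have h1 : p i.succ ≤ p j.castSucc := hp.monotone (Fin.succ_le_castSucc_iff.2 h)
    exact absurd (hi.2.trans_le h1) (not_lt.2 hj.1.le)
  exact le_antisymm (not_lt.1 (key j i hj hi)) (not_lt.1 (key i j hi hj))

/-- The nodes `p i` are outside `S`, so an element supported in `S` fixes them and preserves every
gap; its restrictions determine it. For surjectivity it suffices to hit the tuples concentrated in a
single gap. -/
theorem nonempty_compactSupp_equiv_pi {n : ℕ} {p : Fin (n + 1) → ℝ} (hp : StrictMono p)
    {S : Set ℝ} (hpS : ∀ i, p i ∉ S) (hsub : ∀ i, gap p i ⊆ S)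
    (hcov : ∀ t ∈ S, ∃ i, t ∈ gap p i) :
    Nonempty (compactSupp S ≃* ∀ i, compactSupp (gap p i)) := by
  classical
  let R : ∀ i : Fin n, compactSupp S →* compactSupp (gap p i) := fun i =>
    (restrHom (hpS i.castSucc) (hpS i.succ)).codRestrict _ fun f => restrHom_mem _ _ f
  have hR : ∀ i f t, t ∈ gap p i → (R i f : ℝ ≃o ℝ) t = (f : ℝ ≃o ℝ) t := fun i f t ht =>
    restrHom_of_mem _ _ f ht
  refine ⟨MulEquiv.ofBijective (MonoidHom.pi R) ⟨fun f g h => ?_, ?_⟩⟩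
  · ext t
    by_cases ht : t ∈ S
    · obtain ⟨i, hi⟩ := hcov t ht
      rw [← hR i f t hi, ← hR i g t hi]
      exact congrArg (fun z : ∀ i, compactSupp (gap p i) => (z i : ℝ ≃o ℝ) t) h
    · rw [apply_eq_of_mem_compactSupp f.2 ht, apply_eq_of_mem_compactSupp g.2 ht]
  · rw [← MonoidHom.range_eq_top, Subgroup.eq_top_iff']
    intro y
    refine Subgroup.pi_mem_of_mulSingle_mem y fun i => ?_
    let f : compactSupp S := ⟨y i, compactSupp_mono (hsub i) (y i).2⟩
    refine ⟨f, ?_⟩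
    funext j
    ext t
    by_cases hj : t ∈ gap p j
    · change (R j f : ℝ ≃o ℝ) t = _
      rw [hR j f t hj]
      by_cases hij : i = j
      · subst hij; simp [f]
      · rw [Pi.mulSingle_eq_of_ne (Ne.symm hij)]
        exact apply_eq_of_mem_compactSupp (y i).2 fun hi => hij (gap_unique hp hi hj)
    · rw [apply_eq_of_mem_compactSupp (Subtype.prop _) hj,
        apply_eq_of_mem_compactSupp (Subtype.prop _) hj]

theorem exists_gaps {U : Set ℝ} (hfin : U.Finite) (hU : U ⊆ Ioo 0 1) :
    ∃ p : Fin (U.ncard + 1 + 1) → ℝ, StrictMono p ∧ (∀ i, p i ∉ Ioo 0 1 \ U) ∧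
      (∀ i, gap p i ⊆ Ioo 0 1 \ U) ∧ ∀ t ∈ Ioo 0 1 \ U, ∃ i, t ∈ gap p i := by
  classical
  have h01 : (0 : ℝ) ∉ insert 1 U := by
    rintro (h | h)
    · exact zero_ne_one h
    · exact lt_irrefl _ (hU h).1
  have h1 : (1 : ℝ) ∉ U := fun h => lt_irrefl _ (hU h).2
  have hfin1 : (insert 0 (insert 1 U)).Finite := (hfin.insert 1).insert 0
  have hcard : hfin1.toFinset.card = U.ncard + 1 + 1 := by
    rw [← Set.ncard_eq_toFinset_card _ hfin1, Set.ncard_insert_of_notMem h01 (hfin.insert 1),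
      Set.ncard_insert_of_notMem h1 hfin]
  let p := hfin1.toFinset.orderEmbOfFin hcard
  have hp : StrictMono p := p.strictMono
  have hrange : ∀ t, t ∈ insert 0 (insert 1 U) ↔ ∃ i, p i = t := by
    intro t
    have := Finset.range_orderEmbOfFin hfin1.toFinset hcard
    rw [Finite.coe_toFinset] at this
    rw [← this]; rfl
  have hmem : ∀ i, p i ∈ Icc (0 : ℝ) 1 := by
    intro i
    rcases (hrange _).2 ⟨i, rfl⟩ with h | h | h
    · rw [h]; simp
    · rw [h]; simp
    · exact Ioo_subset_Icc_self (hU h)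
  refine ⟨p, hp, fun i => ?_, fun i t ht => ⟨⟨?_, ?_⟩, fun htU => ?_⟩, fun t ht => ?_⟩
  · rcases (hrange _).2 ⟨i, rfl⟩ with h | h | h
    · rw [h]; simp
    · rw [h]; simp
    · exact fun h' => h'.2 h
  · exact (hmem _).1.trans_lt ht.1
  · exact ht.2.trans_le (hmem _).2
  · obtain ⟨j, rfl⟩ := (hrange t).1 (Or.inr (Or.inr htU))
    have h1 := hp.lt_iff_lt.1 ht.1
    have h2 := hp.lt_iff_lt.1 ht.2
    rw [Fin.lt_def] at h1 h2
    simp at h1 h2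
    omega
  · obtain ⟨i₀, hi₀⟩ := (hrange 0).1 (by simp)
    obtain ⟨i₁, hi₁⟩ := (hrange 1).1 (by simp)
    have hne : (Finset.univ.filter fun i => p i < t).Nonempty :=
      ⟨i₀, by simp [hi₀, ht.1.1]⟩
    obtain ⟨i, hi, hmax⟩ := Finset.exists_maximal hne
    have hit : p i < t := (Finset.mem_filter.1 hi).2
    have hlast : i ≠ Fin.last _ := by
      rintro rfl
      have := hp.monotone (Fin.le_last i₁)
      rw [hi₁] at this
      linarith [ht.1.2]
    obtain ⟨k, rfl⟩ := Fin.exists_castSucc_eq.2 hlast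
    refine ⟨k, hit, lt_of_le_of_ne (not_lt.1 fun hlt => ?_) fun e => ?_⟩
    · have := hmax (Finset.mem_filter.2 ⟨Finset.mem_univ k.succ, hlt⟩)
        (Fin.castSucc_lt_succ).le
      exact absurd this (not_le.2 Fin.castSucc_lt_succ)
    · rcases (hrange t).2 ⟨_, e.symm⟩ with h | h | h
      · exact ht.1.1.ne' h
      · exact ht.1.2.ne h
      · exact ht.2 h

/-! ### Slopes at fixed points -/

/-- The exponents of slopes at `x` of affine dyadic maps fixing `x`. -/
def slopeExponents (x : ℝ) : AddSubgroup ℤ where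
  carrier := {k | IsDyadic ((2 ^ k - 1) * x)}
  zero_mem' := by simpa using isDyadic_zero
  add_mem' := by
    intro k l hk hl
    have : ((2 : ℝ) ^ (k + l) - 1) * x = 2 ^ k * ((2 ^ l - 1) * x) + (2 ^ k - 1) * x := by
      rw [zpow_add₀ two_ne_zero]; ring
    change IsDyadic _
    rw [this]
    exact (IsDyadic.zpow_mul k hl).add hk
  neg_mem' := by
    intro k hk
    have : ((2 : ℝ) ^ (-k) - 1) * x = -(2 ^ (-k) * ((2 ^ k - 1) * x)) := by
      have h : (2 : ℝ) ^ (-k) * 2 ^ k = 1 := by rw [← zpow_add₀ two_ne_zero]; simp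
      linear_combination x * h
    change IsDyadic _
    rw [this]
    exact (IsDyadic.zpow_mul (-k) hk).neg

theorem germ_mem_slopeExponents {x : ℝ} (b : Bool) (f : fixing x) :
    (germ x b f).toAdd ∈ slopeExponents x := by
  obtain ⟨A, hA, h, hx⟩ : ∃ A, DyadicAffine A ∧ (f : ℝ ≃o ℝ) =ᶠ[sideNhds x b] A ∧ A x = x := by
    cases b
    · obtain ⟨A, hA, h⟩ := (f.2.1 x).left
      exact ⟨A, hA, h, (h.eq_of_nhdsWithin self_mem_Iic).symm.trans f.2.2⟩
    · obtain ⟨A, hA, h⟩ := (f.2.1 x).right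
      exact ⟨A, hA, h, (h.eq_of_nhdsWithin self_mem_Ici).symm.trans f.2.2⟩
  obtain ⟨k, d, hd, hAk⟩ := hA
  rw [hAk] at hx
  rw [germ_eq (k := k) (by
    filter_upwards [h] with t ht
    rw [ht, hAk]
    linear_combination hx)]
  change IsDyadic _
  rw [show ((2 : ℝ) ^ k - 1) * x = -d by linear_combination hx]
  exact hd.neg

theorem IsDyadic.exists_rat {x : ℝ} (h : IsDyadic x) : ∃ q : ℚ, (q : ℝ) = x := by
  obtain ⟨a, n, rfl⟩ := h
  exact ⟨a / 2 ^ n, by push_cast; rfl⟩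

/-- For `k ≠ 0` one could divide the dyadic number `(2 ^ k - 1) * x` by `2 ^ k - 1` and find `x`
rational. -/
theorem eq_zero_of_mem_slopeExponents {x : ℝ} (hx : Irrational x) {k : ℤ}
    (hk : k ∈ slopeExponents x) : k = 0 := by
  by_contra hne
  obtain ⟨q, hq⟩ := IsDyadic.exists_rat hk
  have h1 : ((2 : ℝ) ^ k - 1) ≠ 0 := by
    rw [sub_ne_zero]
    intro h
    exact hne (zpow_right_injective₀ (a := (2 : ℝ)) (by norm_num) (by norm_num) (by simpa using h))
  refine hx ⟨q / (2 ^ k - 1), ?_⟩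
  push_cast
  rw [hq]
  field_simp

/-- Euler's theorem: if `o` is the odd part of the denominator, then `o` divides `2 ^ o.totient -
1`, which leaves a power of two in the denominator. -/
theorem exists_ne_zero_mem_slopeExponents (q : ℚ) : ∃ k ≠ 0, k ∈ slopeExponents (q : ℝ) := by
  obtain ⟨m, o, ho, hden⟩ : ∃ m o : ℕ, Odd o ∧ q.den = 2 ^ m * o := by
    obtain ⟨m, o, h1, h2⟩ := Nat.exists_eq_two_pow_mul_odd q.den_nz
    exact ⟨m, o, h1, h2⟩
  have hcop : Nat.Coprime 2 o := Nat.coprime_two_left.2 ho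
  have hmod := Nat.ModEq.pow_totient hcop
  have hopos : 0 < o := ho.pos
  obtain ⟨c, hc⟩ : o ∣ 2 ^ o.totient - 1 :=
    (Nat.modEq_iff_dvd' Nat.one_le_two_pow).1 hmod.symm
  have hc' : (2 : ℝ) ^ o.totient - 1 = o * c := by
    have h1 : 1 ≤ 2 ^ o.totient := Nat.one_le_two_pow
    have := congrArg (Nat.cast (R := ℝ)) hc
    push_cast [h1] at this
    exact this
  refine ⟨(o.totient : ℕ), by exact_mod_cast (Nat.totient_pos.2 hopos).ne', ?_⟩
  refine ⟨c * q.num, m, ?_⟩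
  rw [zpow_natCast, hc', Rat.cast_def, hden]
  have : (o : ℝ) ≠ 0 := by exact_mod_cast hopos.ne'
  push_cast
  field_simp

/-- Subgroups of `ℤ` are cyclic. The generator `n` is the unit in which germs at `x` are later
measured; its sign plays no role. -/
theorem exists_period {x : ℝ} (hx : ¬ Irrational x) : ∃ n : ℤ, n ≠ 0 ∧ n ∈ slopeExponents x ∧
    ∀ k ∈ slopeExponents x, n ∣ k := by
  rw [Irrational, not_not] at hx
  obtain ⟨q, rfl⟩ := hx
  obtain ⟨k, hk0, hk⟩ := exists_ne_zero_mem_slopeExponents q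
  obtain ⟨n, hn⟩ := Int.subgroup_cyclic (slopeExponents (q : ℝ))
  rw [← AddSubgroup.zmultiples_eq_closure] at hn
  have hdvd : ∀ k ∈ slopeExponents (q : ℝ), n ∣ k := by
    intro k hk
    rw [hn] at hk
    exact Int.mem_zmultiples_iff.1 hk
  refine ⟨n, ?_, ?_, hdvd⟩
  · rintro rfl
    exact hk0 (zero_dvd_iff.1 (hdvd k hk))
  · rw [hn]; exact AddSubgroup.mem_zmultiples n

/-! ### Local sections of the germ maps -/

open Classical in
/-- A neighbourhood of the point `x`, one-sided and deleted if `x` is dyadic. -/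
def zone (ε x : ℝ) (b : Bool) : Set ℝ :=
  if IsDyadic x then (if b then Ioo x (x + ε) else Ioo (x - ε) x) else Ioo (x - ε) (x + ε)

theorem zone_of_not_isDyadic {ε x : ℝ} {b : Bool} (h : ¬ IsDyadic x) :
    zone ε x b = Ioo (x - ε) (x + ε) := if_neg h

theorem zone_true {ε x : ℝ} (h : IsDyadic x) : zone ε x true = Ioo x (x + ε) := by
  rw [zone, if_pos h]; rfl

theorem zone_false {ε x : ℝ} (h : IsDyadic x) : zone ε x false = Ioo (x - ε) x := by
  rw [zone, if_pos h]; rfl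

theorem zone_subset {ε : ℝ} (hε : 0 < ε) (x : ℝ) (b : Bool) :
    zone ε x b ⊆ Ioo (x - ε) (x + ε) := by
  by_cases h : IsDyadic x
  · cases b
    · rw [zone_false h]; exact Ioo_subset_Ioo_right (by linarith)
    · rw [zone_true h]; exact Ioo_subset_Ioo_left (by linarith)
  · rw [zone_of_not_isDyadic h]

theorem eventually_zone {ε : ℝ} (hε : 0 < ε) (x : ℝ) (b : Bool) :
    ∀ᶠ t in sideNhds x b, t = x ∨ t ∈ zone ε x b := by
  have h1 : Ioo (x - ε) (x + ε) ∈ 𝓝 x := Ioo_mem_nhds (by linarith) (by linarith)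
  by_cases h : IsDyadic x
  · cases b
    · rw [zone_false h]
      filter_upwards [self_mem_nhdsWithin, nhdsWithin_le_nhds h1] with t h2 h3
      exact (show t ≤ x from h2).eq_or_lt.imp_right fun h4 => ⟨h3.1, h4⟩
    · rw [zone_true h]
      filter_upwards [self_mem_nhdsWithin, nhdsWithin_le_nhds h1] with t h2 h3
      exact (show x ≤ t from h2).eq_or_lt.imp Eq.symm fun h4 => ⟨h4, h3.2⟩
  · rw [zone_of_not_isDyadic h]
    filter_upwards [sideNhds_le x b h1] with t ht using Or.inr ht

theorem exists_bend_right_of_fixing {x ε : ℝ} (hε : 0 < ε) {h : ℝ ≃o ℝ} (hh : h ∈ fixing x) :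
    ∃ c > x, ∃ g ∈ locPL, (∀ t ≤ c, g t = h t) ∧ ∀ t, x + ε ≤ t → g t = t := by
  obtain ⟨b, hb, h1, h2⟩ := exists_dyadic_btwn (show x < x + ε by linarith)
  have h3 : x < h⁻¹ b := by
    rw [← h.lt_iff_lt, apply_inv_self', hh.2]; exact h1
  -- Close enough to `x` that both `c` and `h c` stay below `b`.
  obtain ⟨c, hc, h4, h5⟩ := exists_dyadic_btwn (lt_min h1 h3)
  have h6 : h c < b := by
    have := h.strictMono (h5.trans_le (min_le_right _ _))
    rwa [apply_inv_self'] at this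
  obtain ⟨g, hg, g1, g2⟩ := exists_bend_right hh.1 hc hb (h5.trans_le (min_le_left _ _)) h6 le_rfl
  exact ⟨c, h4, g, hg, g1, fun t ht => g2 t (h2.le.trans ht)⟩

theorem exists_bend_left_of_fixing {x ε : ℝ} (hε : 0 < ε) {h : ℝ ≃o ℝ} (hh : h ∈ fixing x) :
    ∃ c < x, ∃ g ∈ locPL, (∀ t, c ≤ t → g t = h t) ∧ ∀ t ≤ x - ε, g t = t := by
  obtain ⟨a, ha, h1, h2⟩ := exists_dyadic_btwn (show x - ε < x by linarith)
  have h3 : h⁻¹ a < x := by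
    rw [← h.lt_iff_lt, apply_inv_self', hh.2]; exact h2
  obtain ⟨c, hc, h4, h5⟩ := exists_dyadic_btwn (max_lt h2 h3)
  have h6 : a < h c := by
    have := h.strictMono ((le_max_right _ _).trans_lt h4)
    rwa [apply_inv_self'] at this
  obtain ⟨g, hg, g1, g2⟩ := exists_bend_left hh.1 hc ha ((le_max_left _ _).trans_lt h4) h6 le_rfl
  exact ⟨c, h5, g, hg, g1, fun t ht => g2 t (ht.trans h1.le)⟩

/-- Bend `h` to the identity within distance `ε` of `x`. At a dyadic point the other side can be
replaced by the identity, since a break at `x` is allowed; otherwise both sides have to follow `h`.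
-/
theorem exists_localization {x ε : ℝ} (hε : 0 < ε) (b : Bool) {h : ℝ ≃o ℝ} (hh : h ∈ fixing x) :
    ∃ s ∈ fixing x, (∀ t ∉ zone ε x b, s t = t) ∧ ∀ᶠ t in sideNhds x b, s t = h t := by
  by_cases hx : IsDyadic x
  · cases b
    · obtain ⟨c, hc, g, hg, g1, g2⟩ := exists_bend_left_of_fixing hε hh
      have hgx : g x = x := by rw [g1 x hc.le, hh.2]
      have hgx' : g x = (1 : ℝ ≃o ℝ) x := hgx
      refine ⟨glue x g 1 hgx', ⟨glue_mem _ hx hg (one_mem _), ?_⟩, fun t ht => ?_, ?_⟩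
      · rw [glue_of_le _ le_rfl, hgx]
      · rw [zone_false hx] at ht
        rcases le_total x t with h1 | h1
        · rw [glue_of_ge _ h1]; rfl
        · rw [glue_of_le _ h1]
          rcases h1.eq_or_lt with rfl | h1
          · exact hgx
          · exact g2 t (not_lt.1 fun h2 => ht ⟨h2, h1⟩)
      · filter_upwards [self_mem_nhdsWithin, nhdsWithin_le_nhds (Ioi_mem_nhds hc)] with t h1 h2
        rw [glue_of_le _ h1, g1 t (le_of_lt h2)]
    · obtain ⟨c, hc, g, hg, g1, g2⟩ := exists_bend_right_of_fixing hε hh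
      have hgx : g x = x := by rw [g1 x hc.le, hh.2]
      have hgx' : (1 : ℝ ≃o ℝ) x = g x := hgx.symm
      refine ⟨glue x 1 g hgx', ⟨glue_mem _ hx (one_mem _) hg, ?_⟩, fun t ht => ?_, ?_⟩
      · rw [glue_of_le _ le_rfl]; rfl
      · rw [zone_true hx] at ht
        rcases le_total t x with h1 | h1
        · rw [glue_of_le _ h1]; rfl
        · rw [glue_of_ge _ h1]
          rcases h1.eq_or_lt with rfl | h1
          · exact hgx
          · exact g2 t (not_lt.1 fun h2 => ht ⟨h1, h2⟩)
      · filter_upwards [self_mem_nhdsWithin, nhdsWithin_le_nhds (Iio_mem_nhds hc)] with t h1 h2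
        rw [glue_of_ge _ h1, g1 t (le_of_lt h2)]
  · obtain ⟨c, hc, g, hg, g1, g2⟩ := exists_bend_right_of_fixing hε hh
    have hgx : g x = x := by rw [g1 x hc.le, hh.2]
    obtain ⟨c', hc', s, hs, s1, s2⟩ := exists_bend_left_of_fixing hε
      (show g ∈ fixing x from ⟨hg, hgx⟩)
    refine ⟨s, ⟨hs, by rw [s1 x hc'.le, hgx]⟩, fun t ht => ?_, ?_⟩
    · rw [zone_of_not_isDyadic hx] at ht
      rcases le_or_gt t (x - ε) with h1 | h1
      · exact s2 t h1
      · have h2 : x + ε ≤ t := not_lt.1 fun h2 => ht ⟨h1, h2⟩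
        rw [s1 t (by linarith), g2 t h2]
    · filter_upwards [sideNhds_le x b (Ioo_mem_nhds hc' hc)] with t ht
      rw [s1 t ht.1.le, g1 t ht.2.le]

theorem exists_section {x ε : ℝ} (hε : 0 < ε) (b : Bool) {k : ℤ} (hk : k ∈ slopeExponents x) :
    ∃ s : fixing x, (∀ t ∉ zone ε x b, (s : ℝ ≃o ℝ) t = t) ∧ (germ x b s).toAdd = k := by
  have hd : IsDyadic (-((2 ^ k - 1) * x)) := IsDyadic.neg hk
  obtain ⟨s, hs, h1, h2⟩ := exists_localization hε b
    (show affIso k (-((2 ^ k - 1) * x)) ∈ fixing x from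
      ⟨affIso_mem k hd, by rw [affIso_apply]; ring⟩)
  refine ⟨⟨s, hs⟩, h1, germ_eq ?_⟩
  filter_upwards [h2] with t ht
  rw [ht, affIso_apply]
  ring

/-! ### The characters of the stabilizer -/

/-- The one-sided germs that give the characters of the stabilizer of `U`. -/
def germIndex (U : Set ℝ) : Set (ℝ × Bool) :=
  (fun x => (x, true)) '' insert 0 (dyadicPart U) ∪
    (fun x => (x, false)) '' insert 1 (dyadicPart U) ∪ (fun x => (x, true)) '' rationalPart U

section

variable {U : Set ℝ}

theorem mem_germIndex_true {x : ℝ} :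
    (x, true) ∈ germIndex U ↔ x = 0 ∨ x ∈ dyadicPart U ∨ x ∈ rationalPart U := by
  simp [germIndex, or_assoc, eq_comm]

theorem mem_germIndex_false {x : ℝ} :
    (x, false) ∈ germIndex U ↔ x = 1 ∨ x ∈ dyadicPart U := by
  simp [germIndex, eq_comm]

theorem finite_germIndex (hfin : U.Finite) : (germIndex U).Finite :=
  ((((hfin.subset (sep_subset _ _)).insert 0).image _).union
    (((hfin.subset (sep_subset _ _)).insert 1).image _)).union
    ((hfin.subset (sep_subset _ _)).image _)

theorem ncard_germIndex (hfin : U.Finite) (hU : U ⊆ Ioo 0 1) :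
    (germIndex U).ncard = 2 * (dyadicPart U).ncard + (rationalPart U).ncard + 2 := by
  have hd : (dyadicPart U).Finite := hfin.subset (sep_subset _ _)
  have hq : (rationalPart U).Finite := hfin.subset (sep_subset _ _)
  have h0 : (0 : ℝ) ∉ dyadicPart U := fun h => lt_irrefl _ (hU h.1).1
  have h1 : (1 : ℝ) ∉ dyadicPart U := fun h => lt_irrefl _ (hU h.1).2
  have hinj : ∀ b : Bool, Function.Injective fun x : ℝ => (x, b) := fun b x y h =>
    congrArg Prod.fst h
  rw [germIndex, ncard_union_eq _ (((hd.insert 0).image _).union ((hd.insert 1).image _))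
      (hq.image _), ncard_union_eq _ ((hd.insert 0).image _) ((hd.insert 1).image _),
    ncard_image_of_injective _ (hinj _), ncard_image_of_injective _ (hinj _),
    ncard_image_of_injective _ (hinj _), ncard_insert_of_notMem h0 hd,
    ncard_insert_of_notMem h1 hd]
  · ring
  · rw [disjoint_left]
    rintro _ ⟨x, -, rfl⟩ ⟨y, -, h⟩
    simp at h
  · rw [disjoint_left]
    rintro _ (⟨x, hx, rfl⟩ | ⟨x, hx, rfl⟩) ⟨y, hy, h⟩
    · simp only [Prod.mk.injEq, and_true] at h
      subst h
      rcases hx with rfl | hx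
      · exact hy.2.2 isDyadic_zero
      · exact hy.2.2 hx.2
    · simp at h

theorem fst_mem_of_mem_germIndex {i : ℝ × Bool} (hi : i ∈ germIndex U) :
    i.1 ∈ insert 0 (insert 1 U) ∧ ¬ Irrational i.1 := by
  have hd : ∀ x, IsDyadic x → ¬ Irrational x := fun x hx hi => by
    obtain ⟨q, rfl⟩ := IsDyadic.exists_rat hx
    exact hi ⟨q, rfl⟩
  obtain ⟨x, b⟩ := i
  cases b
  · rcases mem_germIndex_false.1 hi with rfl | h
    · exact ⟨by simp, hd _ isDyadic_one⟩
    · exact ⟨Or.inr (Or.inr h.1), hd _ h.2⟩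
  · rcases mem_germIndex_true.1 hi with rfl | h | h
    · exact ⟨by simp, hd _ isDyadic_zero⟩
    · exact ⟨Or.inr (Or.inr h.1), hd _ h.2⟩
    · exact ⟨Or.inr (Or.inr h.1), h.2.1⟩

theorem unitFixing_le_fixing_of_mem {x : ℝ} (hx : x ∈ insert 0 (insert 1 U)) :
    unitFixing U ≤ fixing x := by
  apply unitFixing_le_fixing
  rcases hx with rfl | rfl | hx
  · exact Or.inr (by simp)
  · exact Or.inr (by simp)
  · exact Or.inl hx

/-! ### Disjoint zones and the dual system of characters and elements -/

theorem exists_separation (hfin : U.Finite) : ∃ ε > 0, ∀ x ∈ insert 0 (insert 1 U),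
    ∀ y ∈ insert 0 (insert 1 U), x ≠ y → 2 * ε ≤ |x - y| := by
  have hP : (insert 0 (insert 1 U)).Finite := (hfin.insert 1).insert 0
  have hnt : (insert 0 (insert 1 U)).Nontrivial := ⟨0, by simp, 1, by simp, zero_ne_one⟩
  refine ⟨(insert 0 (insert 1 U)).infsep / 2, half_pos (hP.infsep_pos_iff_nontrivial.2 hnt),
    fun x hx y hy hxy => ?_⟩
  have := Set.infsep_le_dist_of_mem hx hy hxy
  rw [Real.dist_eq] at this
  linarith

/-- Zones at different points are kept apart by `2 * ε`. Two indices at the same point differ in the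
side, and the left side is indexed only at dyadic points, where the zones are one-sided. -/
theorem zone_disjoint {ε : ℝ} (hε : 0 < ε) (hsep : ∀ x ∈ insert 0 (insert 1 U),
    ∀ y ∈ insert 0 (insert 1 U), x ≠ y → 2 * ε ≤ |x - y|) {i j : ℝ × Bool}
    (hi : i ∈ germIndex U) (hj : j ∈ germIndex U) (hij : i ≠ j) :
    Disjoint (zone ε i.1 i.2) (zone ε j.1 j.2) := by
  rw [disjoint_left]
  intro t hti htj
  by_cases hx : i.1 = j.1
  · obtain ⟨x, b⟩ := i
    obtain ⟨y, c⟩ := j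
    obtain rfl : x = y := hx
    have key : ∀ {t}, t ∈ zone ε x true → t ∈ zone ε x false → (x, false) ∈ germIndex U →
        False := by
      intro t h1 h2 h
      have hd : IsDyadic x := by
        rcases mem_germIndex_false.1 h with rfl | h
        · exact isDyadic_one
        · exact h.2
      rw [zone_true hd] at h1
      rw [zone_false hd] at h2
      exact lt_asymm h1.1 h2.2
    cases b <;> cases c
    · exact hij rfl
    · exact key htj hti hi
    · exact key hti htj hj
    · exact hij rfl
  · have h1 := zone_subset hε _ _ hti
    have h2 := zone_subset hε _ _ htj
    have h3 := hsep _ (fst_mem_of_mem_germIndex hi).1 _ (fst_mem_of_mem_germIndex hj).1 hx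
    rcases abs_cases (i.1 - j.1) with h | h
    · linarith [h1.1, h2.2]
    · linarith [h1.2, h2.1]

/-- Ensures that an element supported in a zone lies in the stabilizer. At `0` only the right side
is indexed and at `1` only the left, so no zone leaves `(0, 1)`. -/
theorem notMem_zone {ε : ℝ} (hε : 0 < ε) (hU : U ⊆ Ioo 0 1) (hsep : ∀ x ∈ insert 0 (insert 1 U),
    ∀ y ∈ insert 0 (insert 1 U), x ≠ y → 2 * ε ≤ |x - y|) {i : ℝ × Bool}
    (hi : i ∈ germIndex U) {t : ℝ} (ht : t ∈ U ∨ t ∉ Ioo 0 1) (hti : t ≠ i.1) :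
    t ∉ zone ε i.1 i.2 := by
  have hP := (fst_mem_of_mem_germIndex hi).1
  have hfar : ∀ y ∈ insert 0 (insert 1 U), i.1 ≠ y → y ∉ zone ε i.1 i.2 := by
    intro y hy hne hz
    have h1 := zone_subset hε _ _ hz
    have h2 := hsep _ hP _ hy hne
    rcases abs_cases (i.1 - y) with h | h
    · linarith [h1.1]
    · linarith [h1.2]
  rcases ht with ht | ht
  · exact hfar t (Or.inr (Or.inr ht)) hti.symm
  · intro hz
    have h1 := zone_subset hε _ _ hz
    have hI : i.1 ∈ Icc (0 : ℝ) 1 := by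
      rcases hP with h | h | h
      · rw [h]; simp
      · rw [h]; simp
      · exact Ioo_subset_Icc_self (hU h)
    rcases le_or_gt t 0 with h0 | h0
    · by_cases hx : i.1 = 0
      · obtain ⟨x, b⟩ := i
        obtain rfl : x = 0 := hx
        cases b
        · rcases mem_germIndex_false.1 hi with h | h
          · exact zero_ne_one h
          · exact lt_irrefl _ (hU h.1).1
        · rw [zone_true isDyadic_zero] at hz
          exact absurd hz.1 (not_lt.2 h0)
      · have h2 := hsep _ hP 0 (by simp) hx
        rw [sub_zero, abs_of_nonneg hI.1] at h2
        linarith [h1.1]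
    · have h0' : 1 ≤ t := not_lt.1 fun h => ht ⟨h0, h⟩
      by_cases hx : i.1 = 1
      · obtain ⟨x, b⟩ := i
        obtain rfl : x = 1 := hx
        cases b
        · rw [zone_false isDyadic_one] at hz
          exact absurd hz.2 (not_lt.2 h0')
        · rcases mem_germIndex_true.1 hi with h | h | h
          · exact one_ne_zero h
          · exact lt_irrefl _ (hU h.1).2
          · exact lt_irrefl _ (hU h.1).2
      · have h2 := hsep _ hP 1 (by simp) hx
        rw [abs_sub_comm, abs_of_nonneg (by linarith [hI.2])] at h2
        linarith [h1.2]

/-- An integer-valued homomorphism divided by a common divisor of its values. -/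
def divHom {G : Type*} [Group G] (χ : G →* Multiplicative ℤ) (n : ℤ)
    (h : ∀ g, n ∣ (χ g).toAdd) : G →* Multiplicative ℤ :=
  MonoidHom.mk' (fun g => Multiplicative.ofAdd ((χ g).toAdd / n)) fun g g' => by
    rw [map_mul, toAdd_mul, Int.add_ediv_of_dvd_left (h g), ofAdd_add]

theorem divHom_eq_one_iff {G : Type*} [Group G] {χ : G →* Multiplicative ℤ} {n : ℤ}
    {h : ∀ g, n ∣ (χ g).toAdd} {g : G} : divHom χ n h g = 1 ↔ χ g = 1 := by
  change Multiplicative.ofAdd ((χ g).toAdd / n) = 1 ↔ _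
  rw [ofAdd_eq_one, ← toAdd_eq_zero]
  exact ⟨fun h0 => by rw [← Int.ediv_mul_cancel (h g), h0, zero_mul], fun h0 => by
    rw [h0, Int.zero_ediv]⟩

/-- The germs that are not indexed vanish anyway: outside `[0, 1]` the map is trivial, an irrational
point admits slope `1` only, and at a non-dyadic point the left germ equals the right one. -/
theorem mem_compactSupp_of_germIndex {f : ℝ ≃o ℝ} (hf : f ∈ unitFixing U)
    (h : ∀ i ∈ germIndex U, ∀ hi : f ∈ fixing i.1, germ i.1 i.2 ⟨f, hi⟩ = 1) :
    f ∈ compactSupp (Ioo 0 1 \ U) := by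
  refine mem_compactSupp_of_germs hf.1 hf.2.1 fun p hp hpS => ?_
  have hpP : p ∈ insert 0 (insert 1 U) := by
    by_contra hn
    simp only [mem_insert_iff, not_or] at hn
    exact hpS ⟨⟨hp.1.lt_of_ne (Ne.symm hn.1), hp.2.lt_of_ne hn.2.1⟩, hn.2.2⟩
  have hfix : f ∈ fixing p := unitFixing_le_fixing_of_mem hpP hf
  refine eventually_of_germ_eq_one (f := ⟨f, hfix⟩) ?_
  rcases hpP with rfl | rfl | hpU
  · rintro (_ | _)
    · rw [germ_eq_one_iff]
      filter_upwards [self_mem_nhdsWithin] with t ht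
      exact hf.2.1 t fun h => absurd h.1 (not_lt.2 ht)
    · exact h (0, true) (mem_germIndex_true.2 (Or.inl rfl)) hfix
  · rintro (_ | _)
    · exact h (1, false) (mem_germIndex_false.2 (Or.inl rfl)) hfix
    · rw [germ_eq_one_iff]
      filter_upwards [self_mem_nhdsWithin] with t ht
      exact hf.2.1 t fun h => absurd h.2 (not_lt.2 ht)
  · by_cases hd : IsDyadic p
    · rintro (_ | _)
      · exact h (p, false) (mem_germIndex_false.2 (Or.inr ⟨hpU, hd⟩)) hfix
      · exact h (p, true) (mem_germIndex_true.2 (Or.inr (Or.inl ⟨hpU, hd⟩))) hfix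
    · have htrue : germ p true ⟨f, hfix⟩ = 1 := by
        by_cases hi : Irrational p
        · exact Multiplicative.toAdd.injective
            (eq_zero_of_mem_slopeExponents hi (germ_mem_slopeExponents true _))
        · exact h (p, true) (mem_germIndex_true.2 (Or.inr (Or.inr ⟨hpU, hi, hd⟩))) hfix
      rintro (_ | _)
      · rw [← germ_true_eq_false hd, htrue]
      · exact htrue

theorem eventually_of_mem_compactSupp {S : Set ℝ} {f : ℝ ≃o ℝ} (hf : f ∈ compactSupp S) {p : ℝ}
    (hp : p ∉ S) : ∀ᶠ t in 𝓝 p, f t = t := by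
  obtain ⟨-, K, hK, hKS, h⟩ := hf
  filter_upwards [hK.isClosed.isOpen_compl.mem_nhds fun hh => hp (hKS hh)] with t ht using h t ht

theorem commute_of_disjoint {f g : ℝ ≃o ℝ} {A B : Set ℝ} (hAB : Disjoint A B)
    (hf : ∀ t ∉ A, f t = t) (hg : ∀ t ∉ B, g t = t) : Commute f g := by
  have key : ∀ {f g : ℝ ≃o ℝ} {A B : Set ℝ}, Disjoint A B → (∀ t ∉ A, f t = t) →
      (∀ t ∉ B, g t = t) → ∀ t ∈ A, f (g t) = g (f t) := by
    intro f g A B hAB hf hg t ht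
    have h1 : f t ∈ A := by
      by_contra hn
      have := f.injective (hf _ hn)
      rw [this] at hn
      exact hn ht
    rw [hg t (disjoint_left.1 hAB ht), hg _ (disjoint_left.1 hAB h1)]
  ext t
  change f (g t) = g (f t)
  by_cases hA : t ∈ A
  · exact key hAB hf hg t hA
  · by_cases hB : t ∈ B
    · exact (key hAB.symm hg hf t hB).symm
    · rw [hf t hA, hg t hB, hf t hA]

/-- Each character is a germ divided by its period, and `s i` realizes the period in the zone of
`i`. Disjointness of the zones yields both commutation and the vanishing of `χ i (s j)` for `i ≠ j`.
-/
theorem exists_characters (hfin : U.Finite) (hU : U ⊆ Ioo 0 1) :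
    ∃ (χ : germIndex U → (unitFixing U →* Multiplicative ℤ)) (s : germIndex U → unitFixing U),
      (∀ i j, Commute (s i) (s j)) ∧ (∀ i, χ i (s i) = Multiplicative.ofAdd 1) ∧
      (∀ i j, i ≠ j → χ i (s j) = 1) ∧
      ∀ f, (∀ i, χ i f = 1) ↔ (f : ℝ ≃o ℝ) ∈ compactSupp (Ioo 0 1 \ U) := by
  obtain ⟨ε, hε, hsep⟩ := exists_separation hfin
  have hle : ∀ i : germIndex U, unitFixing U ≤ fixing i.1.1 := fun i =>
    unitFixing_le_fixing_of_mem (fst_mem_of_mem_germIndex i.2).1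
  choose n hn0 hn hdvd using fun i : germIndex U =>
    exists_period (fst_mem_of_mem_germIndex i.2).2
  choose s hs1 hs2 using fun i : germIndex U => exists_section hε i.1.2 (hn i)
  have hsU : ∀ i, (s i : ℝ ≃o ℝ) ∈ unitFixing U := by
    intro i
    have key : ∀ t, (t ∈ U ∨ t ∉ Ioo 0 1) → (s i : ℝ ≃o ℝ) t = t := by
      intro t ht
      by_cases hti : t = i.1.1
      · rw [hti]; exact (s i).2.2
      · exact hs1 i t (notMem_zone hε hU hsep i.2 ht hti)
    exact ⟨(s i).2.1, fun t ht => key t (Or.inr ht), fun t ht => key t (Or.inl ht)⟩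
  let γ : ∀ i : germIndex U, unitFixing U →* Multiplicative ℤ := fun i =>
    (germ i.1.1 i.1.2).comp (Subgroup.inclusion (hle i))
  have hγ : ∀ i f, n i ∣ (γ i f).toAdd := fun i f => hdvd i _ (germ_mem_slopeExponents _ _)
  refine ⟨fun i => divHom (γ i) (n i) (hγ i), fun i => ⟨s i, hsU i⟩, fun i j => ?_, fun i => ?_,
    fun i j hij => ?_, fun f => ⟨fun h => ?_, fun h i => ?_⟩⟩
  · rcases eq_or_ne i j with rfl | hij
    · exact Commute.refl _
    · exact Subtype.ext (commute_of_disjoint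
        (zone_disjoint hε hsep i.2 j.2 (Subtype.coe_injective.ne hij)) (hs1 i) (hs1 j))
  · change Multiplicative.ofAdd ((germ i.1.1 i.1.2 (s i)).toAdd / n i) = _
    rw [hs2, Int.ediv_self (hn0 i)]
  · rw [divHom_eq_one_iff]
    refine germ_eq_one_iff.2 ?_
    filter_upwards [eventually_zone hε i.1.1 i.1.2] with t ht
    rcases ht with rfl | ht
    · exact (hle i (hsU j)).2
    · exact hs1 j t (disjoint_left.1
        (zone_disjoint hε hsep i.2 j.2 (Subtype.coe_injective.ne hij)) ht)
  · exact mem_compactSupp_of_germIndex f.2 fun i hi hfi =>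
      (divHom_eq_one_iff (χ := γ ⟨i, hi⟩)).1 (h ⟨i, hi⟩)
  · rw [divHom_eq_one_iff]
    refine germ_eq_one_iff.2 ?_
    have hP : i.1.1 ∉ Ioo 0 1 \ U := by
      rcases (fst_mem_of_mem_germIndex i.2).1 with h | h | h
      · rw [h]; simp
      · rw [h]; simp
      · exact fun h' => h'.2 h
    exact (eventually_of_mem_compactSupp h hP).filter_mono (sideNhds_le _ _)

end

/-! ### Split extensions by free abelian groups -/

section algebra

variable {G N Q : Type*} [Group G] [Group N] [Group Q]

theorem exists_semidirectProduct_equiv (ι : N →* G) (hι : Function.Injective ι) (π : G →* Q)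
    (sec : Q →* G) (h_sec : ∀ q, π (sec q) = q) (hker : π.ker = ι.range) :
    ∃ φ : Q →* MulAut N, Nonempty (G ≃* N ⋊[φ] Q) := by
  have hn : ι.range.Normal := hker ▸ inferInstance
  let e : N ≃* ι.range := MonoidHom.ofInjective hι
  let φ : Q →* MulAut N :=
    (MulAut.congr e.symm).toMonoidHom.comp ((MulAut.conjNormal (H := ι.range)).comp sec)
  have he : ∀ y : ι.range, ι (e.symm y) = y := fun y =>
    congrArg Subtype.val (e.apply_symm_apply y)
  have hφ : ∀ q n, ι (φ q n) = sec q * ι n * (sec q)⁻¹ := by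
    intro q n
    change ι (e.symm (MulAut.conjNormal (sec q) (e n))) = _
    rw [he, MulAut.conjNormal_apply]
    rfl
  have hπι : ∀ n, π (ι n) = 1 := fun n => by
    have : ι n ∈ π.ker := hker ▸ ⟨n, rfl⟩
    exact this
  let F : N ⋊[φ] Q →* G := SemidirectProduct.lift ι sec fun q => by
    ext n
    exact hφ q n
  have hF : ∀ x : N ⋊[φ] Q, F x = ι x.left * sec x.right := fun _ => rfl
  refine ⟨φ, ⟨(MulEquiv.ofBijective F ⟨?_, fun g => ?_⟩).symm⟩⟩
  · rw [injective_iff_map_eq_one]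
    intro x hx
    rw [hF] at hx
    have h1 : x.right = 1 := by
      have := congrArg π hx
      rwa [map_mul, hπι, h_sec, one_mul, map_one] at this
    rw [h1, map_one, mul_one] at hx
    exact SemidirectProduct.ext ((injective_iff_map_eq_one ι).1 hι _ hx) h1
  · have : g * (sec (π g))⁻¹ ∈ π.ker := by
      rw [MonoidHom.mem_ker, map_mul, map_inv, h_sec, mul_inv_cancel]
    rw [hker] at this
    obtain ⟨n, hn⟩ := this
    refine ⟨⟨n, π g⟩, ?_⟩
    rw [hF]
    simp only [hn, inv_mul_cancel_right]

theorem exists_free_section {ι : Type*} [Finite ι] (χ : ι → (G →* Multiplicative ℤ)) (s : ι → G)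
    (hcomm : ∀ i j, Commute (s i) (s j)) (h1 : ∀ i, χ i (s i) = Multiplicative.ofAdd 1)
    (h2 : ∀ i j, i ≠ j → χ i (s j) = 1) :
    ∃ sec : (ι → Multiplicative ℤ) →* G, ∀ v, MonoidHom.pi χ (sec v) = v := by
  classical
  have := Fintype.ofFinite ι
  let sec : (ι → Multiplicative ℤ) →* G := MonoidHom.noncommPiCoprod
    (fun i => zpowersHom G (s i)) fun i j _ x y => ((hcomm i j).zpow_zpow _ _)
  refine ⟨sec, fun v => ?_⟩
  have : (MonoidHom.pi χ).comp sec = MonoidHom.id _ := by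
    refine MonoidHom.pi_ext fun i x => ?_
    have hsingle : sec (Pi.mulSingle i x) = zpowersHom G (s i) x :=
      MonoidHom.noncommPiCoprod_mulSingle _ _ _
    rw [MonoidHom.comp_apply, hsingle, MonoidHom.id_apply]
    funext j
    rw [zpowersHom_apply, map_zpow, Pi.pow_apply, MonoidHom.pi_apply]
    rcases eq_or_ne j i with rfl | hji
    · rw [h1, Pi.mulSingle_eq_same]
      apply Multiplicative.toAdd.injective
      simp
    · rw [h2 j i hji, one_zpow, Pi.mulSingle_eq_of_ne hji]
  exact DFunLike.congr_fun this v

/-- A perfect subgroup lies in the commutator subgroup, and the kernel of a map to an abelian group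
contains it. -/
theorem ker_eq_commutator {A : Type*} [CommGroup A] (π : G →* A) (h : commutator π.ker = ⊤) :
    π.ker = commutator G := by
  apply le_antisymm
  · rw [commutator_coe_eq_top_iff] at h
    rw [← h, commutator_def]
    exact Subgroup.commutator_mono le_top le_top
  · exact Abelianization.commutator_subset_ker π

theorem rank_groupHomology_one {G : Type} [Group G] {n : ℕ}
    (π : G →* Multiplicative (Fin n → ℤ)) (hπ : Function.Surjective π)
    (h : commutator π.ker = ⊤) :
    Module.rank ℤ (groupHomology (Rep.trivial ℤ G ℤ) 1) = (n : Cardinal) := by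
  let e : Abelianization G ≃* Multiplicative (Fin n → ℤ) :=
    (QuotientGroup.quotientMulEquivOfEq (ker_eq_commutator π h).symm).trans
      (QuotientGroup.quotientKerEquivOfSurjective π hπ)
  let e1 : groupHomology (Rep.trivial ℤ G ℤ) 1 ≃+
      TensorProduct ℤ (Additive (Abelianization G)) ℤ :=
    groupHomology.H1AddEquivOfIsTrivial (Rep.trivial ℤ G ℤ)
  let e2 : Additive (Abelianization G) ≃+ (Fin n → ℤ) := MulEquiv.toAdditiveLeft e
  rw [(e1.toIntLinearEquiv.trans ((TensorProduct.rid ℤ _).trans e2.toIntLinearEquiv)).rank_eq]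
  simp

theorem commutator_pi_eq_top {ι : Type*} [Finite ι] {H : ι → Type*} [∀ i, Group (H i)]
    (h : ∀ i, commutator (H i) = ⊤) : commutator (∀ i, H i) = ⊤ := by
  classical
  rw [Subgroup.eq_top_iff']
  intro x
  refine Subgroup.pi_mem_of_mulSingle_mem x fun i => ?_
  have h1 : x i ∈ commutator (H i) := by rw [h]; trivial
  have h2 := Subgroup.mem_map_of_mem (MonoidHom.mulSingle H i) h1
  rw [commutator_def, Subgroup.map_commutator] at h2
  exact Subgroup.commutator_mono le_top le_top h2

end algebra

/-! ### Assembly of the main theorem -/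

theorem nonempty_compactSupp_equiv_diff {U : Set ℝ} (hfin : U.Finite) (hU : U ⊆ Ioo 0 1) :
    Nonempty ((Fin (U.ncard + 1) → commutator thompsonF) ≃* compactSupp (Ioo 0 1 \ U)) := by
  obtain ⟨p, hp, h1, h2, h3⟩ := exists_gaps hfin hU
  obtain ⟨e⟩ := nonempty_compactSupp_equiv_pi hp h1 h2 h3
  have h : ∀ i, Nonempty (commutator thompsonF ≃* compactSupp (gap p i)) := fun i =>
    nonempty_commutator_equiv (hp Fin.castSucc_lt_succ)
  exact ⟨(MulEquiv.piCongrRight fun i => (h i).some).trans e.symm⟩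

end Thompson

open Thompson in
theorem mainTheorem3 (U : Set ℝ) (hfin : U.Finite) (hU : U ⊆ Set.Ioo 0 1)
    (r m₁ m₂ : ℕ) (hr : r = U.ncard) (hm₁ : m₁ = (dyadicPart U).ncard)
    (hm₂ : m₂ = (rationalPart U).ncard) :
    (∃ φ : Multiplicative (Fin (2 * m₁ + m₂ + 2) → ℤ) →*
          MulAut (Fin (r + 1) → commutator thompsonF),
      Nonempty (pointStabilizer U ≃*
        (Fin (r + 1) → commutator thompsonF) ⋊[φ]
          Multiplicative (Fin (2 * m₁ + m₂ + 2) → ℤ))) ∧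
    Module.rank ℤ (groupHomology (Rep.trivial ℤ (pointStabilizer U) ℤ) 1) =
      ((2 * m₁ + m₂ + 2 : ℕ) : Cardinal) := by
  subst hr
  have hfinJ := (finite_germIndex hfin).to_subtype
  have hcard : Nat.card (germIndex U) = 2 * m₁ + m₂ + 2 := by
    rw [Nat.card_coe_set_eq, ncard_germIndex hfin hU, hm₁, hm₂]
  let e : Fin (2 * m₁ + m₂ + 2) ≃ germIndex U := (Finite.equivFinOfCardEq hcard).symm
  obtain ⟨χ, s, hcomm, h1, h2, hker⟩ := exists_characters hfin hU
  let E : pointStabilizer U ≃* unitFixing U :=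
    (Subgroup.equivMapOfInjective _ _ extHom_injective).trans
      (MulEquiv.subgroupCongr (map_pointStabilizer hU))
  obtain ⟨sec, h_sec⟩ := exists_free_section (fun i => χ (e i)) (fun i => s (e i))
    (fun i j => hcomm _ _) (fun i => h1 _) fun i j hij => h2 _ _ (e.injective.ne hij)
  let M : Multiplicative (Fin (2 * m₁ + m₂ + 2) → ℤ) ≃*
      (Fin (2 * m₁ + m₂ + 2) → Multiplicative ℤ) := MulEquiv.funMultiplicative _ _
  let π : pointStabilizer U →* Multiplicative (Fin (2 * m₁ + m₂ + 2) → ℤ) :=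
    M.symm.toMonoidHom.comp ((MonoidHom.pi fun i => χ (e i)).comp E.toMonoidHom)
  let τ : Multiplicative (Fin (2 * m₁ + m₂ + 2) → ℤ) →* pointStabilizer U :=
    E.symm.toMonoidHom.comp (sec.comp M.toMonoidHom)
  have hτ : ∀ q, π (τ q) = q := by
    intro q
    change M.symm (MonoidHom.pi (fun i => χ (e i)) (E (E.symm (sec (M q))))) = q
    rw [E.apply_symm_apply, h_sec, M.symm_apply_apply]
  have hπ : ∀ f, f ∈ π.ker ↔ (E f : ℝ ≃o ℝ) ∈ compactSupp (Set.Ioo 0 1 \ U) := by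
    intro f
    rw [← hker, MonoidHom.mem_ker]
    change M.symm (MonoidHom.pi (fun i => χ (e i)) (E f)) = 1 ↔ _
    rw [EmbeddingLike.map_eq_one_iff, funext_iff]
    exact e.forall_congr fun _ => Iff.rfl
  obtain ⟨D⟩ := nonempty_compactSupp_equiv_diff hfin hU
  have hle : compactSupp (Set.Ioo 0 1 \ U) ≤ unitFixing U := fun f hf =>
    ⟨hf.1, fun t ht => apply_eq_of_mem_compactSupp hf fun h => ht h.1,
      fun t ht => apply_eq_of_mem_compactSupp hf fun h => h.2 ht⟩
  let ι : (Fin (U.ncard + 1) → commutator thompsonF) →* pointStabilizer U :=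
    E.symm.toMonoidHom.comp ((Subgroup.inclusion hle).comp D.toMonoidHom)
  have hι : Function.Injective ι :=
    E.symm.injective.comp ((Subgroup.inclusion_injective hle).comp D.injective)
  have hrange : π.ker = ι.range := by
    ext f
    rw [hπ]
    constructor
    · intro hf
      refine ⟨D.symm ⟨_, hf⟩, ?_⟩
      change E.symm (Subgroup.inclusion hle (D (D.symm ⟨_, hf⟩))) = f
      rw [D.apply_symm_apply, E.symm_apply_eq]
      rfl
    · rintro ⟨x, rfl⟩
      change (E (E.symm (Subgroup.inclusion hle (D x))) : ℝ ≃o ℝ) ∈ _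
      rw [E.apply_symm_apply]
      exact (D x).2
  refine ⟨exists_semidirectProduct_equiv ι hι π τ hτ hrange,
    rank_groupHomology_one π (fun q => ⟨_, hτ q⟩) ?_⟩
  -- The kernel is a finite product of copies of `[F, F]`, which is perfect, so it is perfect
  -- itself; this gives the homology.
  exact commutator_eq_top_of_equiv
    ((MonoidHom.ofInjective hι).trans (MulEquiv.subgroupCongr hrange.symm))
    (commutator_pi_eq_top fun _ => commutator_commutator_thompsonF)
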